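/- **Theorem 2.** For $n\ge 1$ let $\log^*n=\min\{r\mid \log_2^{(r)}n<2\}$, where $^{(r)}$ denotes the $r$-fold iterated logarithm. There is a universal constant $C$ such that the following holds for all integers $k\ge1$, $n\ge2$, $d\ge1$, all $M\le 2^n$, and all real $t,\Lambda,\epsilon>0$ such that $\tau=\Lambda t$ satisfies $12\,d^2\,5^{k-1}\tau\ge 1$. *Black box.* Let $H$ be a Hermitian $M\times M$ matrix (a Hamiltonian on $n$ qubits, if $M=2^n$) with at most $d$ nonzero entries in each column and with spectral norm $\|H\|\le\Lambda$ (for instance $\Lambda=\|H\|$, so that $\tau=\|H\|t$). A black-box function for $H$ is a function $f$ such that, for each $x$, if the nonzero elements belonging to $x$ are in positions $y_1,\dots,y_{d'}$ (in an arbitrary order, $d'\le d$), then $f(x,i)=(y_i,H_{x,y_i})$ for $i\le d'$ and $f(x,i)=(x,0)$ for $d'<i\le d$. The matrix elements are represented by labels from a finite set of machine numbers, with an error of at most $\Lambda/2^{n'}$ for an integer $n'>5+\log_2(\tau d^2 5^k/\epsilon)$ (exact representation is a special case). The function is accessed through a unitary $U_f$ with $U_f|x,i\rangle|0\rangle=|\phi_{x,i}\rangle|f(x,i)\rangle$,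 where $|\phi_{x,i}\rangle$ are arbitrary states of the input register and of a finite working space; calls to $U_f$ and to $U_f^\dagger$ are allowed. *Claim.* Given $k,n,d,M,\Lambda,t,\epsilon,n'$, the set of machine numbers and the registers, there is a quantum circuit, composed of calls to $U_f$ and $U_f^\dagger$ and of unitary gates on the system, the registers of $U_f$ and finitely many ancillas, in which the gates depend neither on $H$, nor on $f$, nor on $U_f$, and in which the number $N_{\rm bb}$ of calls satisfies $$N_{\rm bb}\le C\,(\log^*n)\,d^2\,5^{2k}\,(d^2\tau)^{1+1/2k}/\epsilon^{1/2k},$$ such that for every such $H$, $f$ and $U_f$ and every initial pure state $|\psi\rangle$ of the system (all the other registers being blank) the final state of the whole register has trace distance at most $\epsilon$ from the state $e^{-iHt}|\psi\rangle$ with all the other registers blank. (The trace distance is $D(\rho,\sigma)=\tfrac12{\rm Tr}|\rho-\sigma|$.) -/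

import Mathlib

open scoped Matrix Kronecker

noncomputable section

namespace SparseSim

/-- The iterated logarithm `log* n = min {r | log₂^(r) n < 2}`. -/
def logStar (n : ℕ) : ℕ :=
  sInf {r : ℕ | (Real.logb 2)^[r] (n : ℝ) < 2}

/-- The spectral norm of a matrix: its operator norm with respect to the Euclidean norm. -/
def specNorm {M : ℕ} (H : Matrix (Fin M) (Fin M) ℂ) : ℝ :=
  ‖Matrix.toEuclideanCLM (𝕜 := ℂ) H‖

/-- `H` has at most `d` nonzero entries in each column. -/
def IsSparse {M : ℕ} (d : ℕ) (H : Matrix (Fin M) (Fin M) ℂ) : Prop :=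
  ∀ y, {x | H x y ≠ 0}.ncard ≤ d

/-- The time evolution operator `exp (-i H t)`. -/
def evolution {M : ℕ} (H : Matrix (Fin M) (Fin M) ℂ) (t : ℝ) : Matrix (Fin M) (Fin M) ℂ :=
  NormedSpace.exp ((-(Complex.I * (t : ℂ))) • H)

/-! ### The black box -/

/-- `f` is a black-box function for the nonzero entries of `H`, with precision `δ`. The labels
in the finite set `E` are the machine numbers, `val` is the complex number that a label
represents and `zero` is the label of `0`. If the nonzero entries belonging to `x` are at
`y₁, …, y_{d'}` (in any order), then `f (x, i)` consists of `y_i` and a label that represents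
`H x y_i` up to an error of at most `δ` for the first `d'` indices `i`, and
`f (x, i) = (x, zero)` for the remaining ones. -/
def IsBlackBox {M d : ℕ} {E : Type} (val : E → ℂ) (zero : E) (δ : ℝ)
    (H : Matrix (Fin M) (Fin M) ℂ) (f : Fin M × Fin d → Fin M × E) : Prop :=
  ∀ x : Fin M, ∃ d' : ℕ, d' ≤ d ∧
    Set.BijOn (fun i : Fin d => (f (x, i)).1) {i | (i : ℕ) < d'} {y | H x y ≠ 0} ∧
    (∀ i : Fin d, (i : ℕ) < d' → ‖val (f (x, i)).2 - H x (f (x, i)).1‖ ≤ δ) ∧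
    (∀ i : Fin d, d' ≤ (i : ℕ) → f (x, i) = (x, zero))

/-- The basis labels of the registers on which the black-box unitary acts: the input `(x, i)`,
additional working space `G`, and the output `(y, label)`. -/
abbrev QueryReg (M d : ℕ) (E G : Type) : Type :=
  ((Fin M × Fin d) × G) × (Fin M × E)

/-- `U |x, i⟩ |0⟩ = |φ_{x,i}⟩ |f (x, i)⟩` for all `(x, i)`, where `|φ_{x,i}⟩` is any state of the
input register and the working space. The blank state `|0⟩` of the working space and of the
output register is `|g₀⟩ |b₀⟩`. -/
def Implements {M d : ℕ} {E G : Type} [Fintype E] [DecidableEq E] [Fintype G] [DecidableEq G]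
    (g₀ : G) (b₀ : Fin M × E) (f : Fin M × Fin d → Fin M × E)
    (U : Matrix (QueryReg M d E G) (QueryReg M d E G) ℂ) : Prop :=
  ∃ φ : Fin M × Fin d → (Fin M × Fin d) × G → ℂ,
    ∀ (a : Fin M × Fin d) (r : QueryReg M d E G),
      (U *ᵥ Pi.single ((a, g₀), b₀) 1) r = if r.2 = f a then φ a r.1 else 0

/-! ### Quantum circuits with black-box calls -/

/-- The basis labels of the whole register: the system `S`, an ancilla register of dimension
`w + 1`, and the registers `Q` on which the black box acts. -/
abbrev TotalReg (S : Type) (w : ℕ) (Q : Type) : Type :=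
  (S × Fin (w + 1)) × Q

/-- One step of a circuit: a unitary gate that does not depend on the black box, a call to the
black-box unitary `U`, or a call to `U†`. -/
inductive Step (S : Type) [Fintype S] [DecidableEq S] (w : ℕ)
    (Q : Type) [Fintype Q] [DecidableEq Q] : Type
  | gate (V : Matrix.unitaryGroup (TotalReg S w Q) ℂ) : Step S w Q
  | call : Step S w Q
  | callInv : Step S w Q

section Circuit

variable {S : Type} [Fintype S] [DecidableEq S] {w : ℕ} {Q : Type} [Fintype Q] [DecidableEq Q]

/-- The operator of a step, when the black-box unitary is `U`. -/
def Step.op (U : Matrix Q Q ℂ) : Step S w Q → Matrix (TotalReg S w Q) (TotalReg S w Q) ℂ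
  | .gate V => V
  | .call => (1 : Matrix (S × Fin (w + 1)) (S × Fin (w + 1)) ℂ) ⊗ₖ U
  | .callInv => (1 : Matrix (S × Fin (w + 1)) (S × Fin (w + 1)) ℂ) ⊗ₖ Uᴴ

/-- The number of black-box calls of a step. -/
def Step.calls : Step S w Q → ℕ
  | .gate _ => 0
  | .call => 1
  | .callInv => 1

/-- The operator of a circuit, a list of steps of which the head is applied first. -/
def circuitOp (U : Matrix Q Q ℂ) :
    List (Step S w Q) → Matrix (TotalReg S w Q) (TotalReg S w Q) ℂ
  | [] => 1
  | s :: c => circuitOp U c * s.op U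

/-- The number of calls to `U` and `U†` in a circuit. -/
def numCalls (c : List (Step S w Q)) : ℕ :=
  (c.map Step.calls).sum

/-- The state `|ψ⟩ |0⟩ |q₀⟩` of the whole register. -/
def embed (w : ℕ) (q₀ : Q) (ψ : S → ℂ) : TotalReg S w Q → ℂ :=
  fun r => if r.1.2 = 0 ∧ r.2 = q₀ then ψ r.1.1 else 0

end Circuit

/-! ### Trace distance -/

/-- The density matrix `|v⟩⟨v|`. -/
def pureState {R : Type} (v : R → ℂ) : Matrix R R ℂ :=
  Matrix.vecMulVec v (star v)

/-- The trace norm `Tr |A| = Tr √(A† A)`, the sum of the singular values of `A`. -/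
def traceNorm {R : Type} [Fintype R] [DecidableEq R] (A : Matrix R R ℂ) : ℝ :=
  ∑ i, Real.sqrt ((Matrix.isHermitian_conjTranspose_mul_self A).eigenvalues i)

/-- The trace distance `D(ρ, σ) = (1/2) Tr |ρ - σ|`. -/
def traceDist {R : Type} [Fintype R] [DecidableEq R] (ρ σ : Matrix R R ℂ) : ℝ :=
  traceNorm (ρ - σ) / 2

/-- The circuit `c`, whose registers start in the blank state, simulates the evolution of `H`
for time `t` with error at most `ε` when the black-box unitary is `U`: for every initial state
of the system, the final state of the whole register has trace distance at most `ε` from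
`exp (-i H t) |ψ⟩` with all the other registers blank. -/
def Simulates {M w : ℕ} {Q : Type} [Fintype Q] [DecidableEq Q] (q₀ : Q)
    (c : List (Step (Fin M) w Q)) (U : Matrix Q Q ℂ)
    (H : Matrix (Fin M) (Fin M) ℂ) (t ε : ℝ) : Prop :=
  ∀ ψ : Fin M → ℂ, ∑ x, ‖ψ x‖ ^ 2 = 1 →
    traceDist (pureState (circuitOp U c *ᵥ embed w q₀ ψ))
      (pureState (embed w q₀ (evolution H t *ᵥ ψ))) ≤ ε

end SparseSim

end

open SparseSim

/-!
# Simulation of sparse Hamiltonians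

**Block encoding.** An *arc* `(x, i, j)` stands for the `i`-th black-box entry of row `x`, together
with a guess `j` of the index under which the entry is found again in the other row. Writing
`(y, u) = f (x, i)` and `(x', v) = f (y, j)`, the arc is matched if `x' = x`, and `i = j` in case
`y = x`; its reversal is then `(y, j, i)`. Reversing the matched arcs and fixing the others is an
involution, whatever `f` is.
The walk `W` (`walk`) reverses the arc and rotates one extra qubit by a dilation of an amplitude
computed from the two labels, symmetrised so that `W` is both unitary and Hermitian
(`walk_unitary`, `walk_isHermitian`). If `J` (`start`) sends `x` to the uniform superposition of its
arcs, the block `Jᴴ W J` is `H / (2 d² Λ)` up to the precision of the labels (`norm_block_sub_le`).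
A query needs a call and its inverse, to clean the working space; the walk takes eight calls
(`implementable_walk`), and in a controlled walk only the gate between the queries has to be
controlled, because the queries before and after it cancel otherwise.

**Exponential of the block.** Let `V = (2 J Jᴴ - 1) W` be the walk operator. Its Hermitian part
`Θ = (V + V⁻¹) / 2` leaves the range of `J` invariant and acts there as the block `Jᴴ W J`
(`generator_mul`). Hence on the range of `J` the evolution for a short time is `exp (-i β Θ)`,
and the truncated series of degree `K` is a Laurent polynomial in `V`. For `β ≤ 1 / 2` its
coefficients have absolute sum at most `2` (`hasWeight_taylorPoly`), so a linear combination of the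
unitaries `V ^ m`, with `m` in a counter register, has half of the truncated exponential as a block
(`exists_amplitudes`, `attach_block`). A single step of amplitude amplification turns the block
`U / 2`, for `U` close to a unitary, into `U`, with a blank final state of the other registers
(`norm_sq_amplify_sub_le`). This is one segment (`exists_segment`).

**Counting.** The evolution for time `t` consists of `r` segments, with `r` proportional to `d² τ`,
and takes `72 K r` calls (`exists_simulation`). The error decays exponentially in `K`, so `K` is
logarithmic in `d² τ / ε`, and such a logarithm is at most a constant times
`5 ^ (2 k) (d² τ / ε) ^ (1 / 2 k)` for every `k` (`exists_parameters`). The bound in the theorem is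
weaker by the factor `d² log* n`, of which only `1 ≤ d² log* n` is used. If `ε ≥ 2`, the empty
circuit is good enough.
-/

noncomputable section

set_option linter.unusedSectionVars false
set_option synthInstance.maxSize 1000

namespace SparseSim

open scoped Matrix.Norms.L2Operator

/-! ### Isometries between registers -/

section Isometry

variable {Ω Y Z : Type} [Fintype Ω] [DecidableEq Ω] [Fintype Y] [DecidableEq Y]
  [Fintype Z] [DecidableEq Z]

/-- The matrix `|y⟩ ↦ |ι y⟩` between registers with basis labels `Y` and `Ω`. -/
def inj (ι : Y → Ω) : Matrix Ω Y ℂ := (1 : Matrix Ω Ω ℂ).submatrix id ι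

lemma inj_apply (ι : Y → Ω) (a : Ω) (y : Y) : inj ι a y = if a = ι y then 1 else 0 := by
  simp [inj, Matrix.one_apply]

lemma mul_inj (T : Matrix Z Ω ℂ) (ι : Y → Ω) : T * inj ι = T.submatrix id ι := by
  ext a y; simp [Matrix.mul_apply, inj_apply]

lemma conjTranspose_inj_mul (T : Matrix Ω Z ℂ) (ι : Y → Ω) :
    (inj ι)ᴴ * T = T.submatrix ι id := by
  ext a y; simp [Matrix.mul_apply, inj_apply]

lemma inj_comp (ι : Y → Ω) (κ : Z → Y) : inj (ι ∘ κ) = inj ι * inj κ := by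
  rw [mul_inj]; ext a y; simp [inj_apply]

lemma inj_isometry {ι : Y → Ω} (hι : Function.Injective ι) : (inj ι)ᴴ * inj ι = 1 := by
  rw [conjTranspose_inj_mul]; ext a y; simp [inj_apply, Matrix.one_apply, hι.eq_iff]

/-- Any isometry of a subset of the basis states extends to a unitary. -/
lemma exists_unitary_mul_inj {ι : Y → Ω} (hι : Function.Injective ι) {A : Matrix Ω Y ℂ}
    (hA : Aᴴ * A = 1) : ∃ G ∈ Matrix.unitaryGroup Ω ℂ, G * inj ι = A := by
  classical
  let v : Ω → EuclideanSpace ℂ Ω := fun a =>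
    if h : ∃ y, ι y = a then WithLp.toLp 2 (fun r => A r h.choose) else 0
  have hv : ∀ y, v (ι y) = WithLp.toLp 2 (fun r => A r y) := by
    intro y
    have h : ∃ y', ι y' = ι y := ⟨y, rfl⟩
    have : h.choose = y := hι h.choose_spec
    simp only [v, dif_pos h, this]
  have hin : ∀ y y', inner ℂ (v (ι y)) (v (ι y')) = if y = y' then (1 : ℂ) else 0 := by
    intro y y'
    have := congrFun (congrFun hA y) y'
    rw [Matrix.one_apply] at this
    rw [← this, hv, hv]
    simp [Matrix.mul_apply, PiLp.inner_apply, mul_comm]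
  have ho : Orthonormal ℂ ((Set.range ι).domRestrict v) := by
    rw [orthonormal_iff_ite]
    rintro ⟨_, y, rfl⟩ ⟨_, y', rfl⟩
    simp [Set.domRestrict, hin, Subtype.ext_iff, hι.eq_iff]
  obtain ⟨b, hb⟩ := ho.exists_orthonormalBasis_extension_of_card_eq
    (by simp : Module.finrank ℂ (EuclideanSpace ℂ Ω) = Fintype.card Ω)
  refine ⟨Matrix.of fun r c => b c r, ?_, ?_⟩
  · rw [Matrix.mem_unitaryGroup_iff']
    ext i j
    have := orthonormal_iff_ite.1 b.orthonormal i j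
    rw [Matrix.one_apply, ← this, Matrix.mul_apply, PiLp.inner_apply]
    simp [Matrix.star_apply, mul_comm]
  · rw [mul_inj]
    ext r y
    have := hb (ι y) ⟨y, rfl⟩
    simp [this, hv]

lemma norm_le_one_of_isometry {A : Matrix Ω Y ℂ} (hA : Aᴴ * A = 1) : ‖A‖ ≤ 1 := by
  have h := Matrix.l2_opNorm_conjTranspose_mul_self A
  rw [hA] at h
  have h1 : ‖(1 : Matrix Y Y ℂ)‖ ≤ 1 := by
    rw [← Matrix.diagonal_one, Matrix.l2_opNorm_diagonal]
    exact (pi_norm_le_iff_of_nonneg zero_le_one).2 (by simp)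
  nlinarith [norm_nonneg A]

lemma norm_unitary_le_one {A : Matrix Y Y ℂ} (hA : A ∈ Matrix.unitaryGroup Y ℂ) : ‖A‖ ≤ 1 :=
  norm_le_one_of_isometry (Matrix.mem_unitaryGroup_iff'.1 hA)

lemma norm_mul_le_of_norm_le_one {A : Matrix Z Ω ℂ} {B : Matrix Ω Y ℂ} {a b : ℝ}
    (hA : ‖A‖ ≤ a) (hB : ‖B‖ ≤ b) : ‖A * B‖ ≤ a * b :=
  (Matrix.l2_opNorm_mul A B).trans
    (mul_le_mul hA hB (norm_nonneg _) ((norm_nonneg _).trans hA))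

lemma unitary_conjTranspose {A : Matrix Y Y ℂ} (hA : A ∈ Matrix.unitaryGroup Y ℂ) :
    Aᴴ ∈ Matrix.unitaryGroup Y ℂ := by
  simpa [Matrix.star_eq_conjTranspose] using Unitary.star_mem hA

/-- The reflection about the range of an isometry. -/
lemma reflection_unitary {J : Matrix Ω Y ℂ} (hJ : Jᴴ * J = 1) :
    (2 : ℂ) • (J * Jᴴ) - 1 ∈ Matrix.unitaryGroup Ω ℂ := by
  have hP : J * Jᴴ * (J * Jᴴ) = J * Jᴴ := by
    rw [Matrix.mul_assoc, ← Matrix.mul_assoc Jᴴ, hJ, Matrix.one_mul]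
  rw [Matrix.mem_unitaryGroup_iff, Matrix.star_eq_conjTranspose]
  simp only [Matrix.conjTranspose_sub, Matrix.conjTranspose_smul, Matrix.conjTranspose_mul,
    Matrix.conjTranspose_conjTranspose, Matrix.conjTranspose_one]
  simp only [sub_mul, mul_sub, smul_mul_assoc, mul_smul_comm, hP, mul_one, one_mul]
  simp only [star_ofNat]
  module

end Isometry

/-! ### Amplitude amplification -/

section Amplify

variable {Ω Y Z : Type} [Fintype Ω] [DecidableEq Ω] [Fintype Y] [DecidableEq Y]
  [Fintype Z] [DecidableEq Z]

/-- If the block `Jᴴ Q J` of a unitary `Q` is close to a unitary `E`, then `Q` nearly preserves the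
range of `J`, so that no projection is needed to compare `Q J` with `J E`. -/
lemma norm_sq_sub_le_of_block {Q : Matrix Ω Ω ℂ} {J : Matrix Ω Y ℂ} {E : Matrix Y Y ℂ} {ξ : ℝ}
    (hQ : Q ∈ Matrix.unitaryGroup Ω ℂ) (hJ : Jᴴ * J = 1) (hE : E ∈ Matrix.unitaryGroup Y ℂ)
    (h : ‖Jᴴ * Q * J - E‖ ≤ ξ) : ‖Q * J - J * E‖ ^ 2 ≤ 2 * ξ := by
  have hQ' : Qᴴ * Q = 1 := Matrix.mem_unitaryGroup_iff'.1 hQ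
  have hE' : Eᴴ * E = 1 := Matrix.mem_unitaryGroup_iff'.1 hE
  have key : (Q * J - J * E)ᴴ * (Q * J - J * E)
      = -((Jᴴ * Q * J - E)ᴴ * E + Eᴴ * (Jᴴ * Q * J - E)) := by
    have e1 : Jᴴ * Qᴴ * (Q * J) = 1 := by
      rw [Matrix.mul_assoc, ← Matrix.mul_assoc Qᴴ, hQ', Matrix.one_mul, hJ]
    have e2 : Eᴴ * Jᴴ * (J * E) = 1 := by
      rw [Matrix.mul_assoc, ← Matrix.mul_assoc Jᴴ, hJ, Matrix.one_mul, hE']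
    simp only [Matrix.conjTranspose_sub, Matrix.conjTranspose_mul,
      Matrix.conjTranspose_conjTranspose, Matrix.sub_mul, Matrix.mul_sub, e1, e2, hE']
    simp only [Matrix.mul_assoc]
    abel
  rw [sq, ← Matrix.l2_opNorm_conjTranspose_mul_self, key, norm_neg]
  refine (norm_add_le _ _).trans ?_
  have hE1 := norm_unitary_le_one hE
  have a1 := norm_mul_le_of_norm_le_one (A := (Jᴴ * Q * J - E)ᴴ)
    ((Matrix.l2_opNorm_conjTranspose _).trans_le h) hE1
  have a2 := norm_mul_le_of_norm_le_one (A := Eᴴ)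
    ((Matrix.l2_opNorm_conjTranspose _).trans_le hE1) h
  linarith

/-- Robust oblivious amplitude amplification: if the block of `T` is half of a matrix close to a
unitary `E`, then three uses of `T` realize `E` itself, since `sin (3 · 30°) = 1`. -/
lemma norm_sq_amplify_sub_le {T : Matrix Ω Ω ℂ} {J : Matrix Ω Y ℂ} {B E : Matrix Y Y ℂ} {η : ℝ}
    (hT : T ∈ Matrix.unitaryGroup Ω ℂ) (hJ : Jᴴ * J = 1) (hE : E ∈ Matrix.unitaryGroup Y ℂ)
    (hB : Jᴴ * T * J = (1 / 2 : ℂ) • B) (h : ‖B - E‖ ≤ η) (hη : η ≤ 1) :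
    ‖-(T * ((2 : ℂ) • (J * Jᴴ) - 1) * Tᴴ * ((2 : ℂ) • (J * Jᴴ) - 1) * T) * J - J * E‖ ^ 2
      ≤ 10 * η := by
  set R : Matrix Ω Ω ℂ := (2 : ℂ) • (J * Jᴴ) - 1 with hR
  have hRu : R ∈ Matrix.unitaryGroup Ω ℂ := reflection_unitary hJ
  have hT' : Tᴴ * T = 1 := Matrix.mem_unitaryGroup_iff'.1 hT
  have hT'' : T * Tᴴ = 1 := Matrix.mem_unitaryGroup_iff.1 hT
  have hEE : E * Eᴴ = 1 := Matrix.mem_unitaryGroup_iff.1 hE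
  have hQ : -(T * R * Tᴴ * R * T) ∈ Matrix.unitaryGroup Ω ℂ := by
    have hm := mul_mem (mul_mem (mul_mem (mul_mem hT hRu) (unitary_conjTranspose hT)) hRu) hT
    rw [Matrix.mem_unitaryGroup_iff] at hm ⊢
    rw [star_neg, neg_mul_neg, hm]
  have hBH : Jᴴ * Tᴴ * J = (1 / 2 : ℂ) • Bᴴ := by
    have := congrArg Matrix.conjTranspose hB
    simpa [Matrix.conjTranspose_smul, Matrix.mul_assoc] using this
  have hX : Jᴴ * -(T * R * Tᴴ * R * T) * J
      = (3 / 2 : ℂ) • B - (1 / 2 : ℂ) • (B * Bᴴ * B) := by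
    have e1 : T * R * Tᴴ * R * T
        = (4 : ℂ) • (T * J * (Jᴴ * Tᴴ * J) * (Jᴴ * T)) - (2 : ℂ) • (T * J * Jᴴ)
          - (2 : ℂ) • (J * (Jᴴ * T)) + T := by
      have a : T * R * Tᴴ = (2 : ℂ) • (T * J * (Jᴴ * Tᴴ)) - 1 := by
        rw [hR, Matrix.mul_sub, Matrix.sub_mul, Matrix.mul_one, hT'']
        simp [Matrix.mul_assoc]
      have b : R * T = (2 : ℂ) • (J * (Jᴴ * T)) - T := by
        rw [hR, Matrix.sub_mul, Matrix.one_mul]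
        simp [Matrix.mul_assoc]
      have c : T * J * (Jᴴ * Tᴴ) * T = T * J * Jᴴ := by
        simp only [Matrix.mul_assoc]; rw [hT', Matrix.mul_one]
      rw [Matrix.mul_assoc (T * R * Tᴴ), a, b, Matrix.sub_mul, Matrix.mul_sub, Matrix.mul_sub,
        Matrix.one_mul, Matrix.one_mul, Matrix.smul_mul, Matrix.mul_smul, Matrix.smul_mul, c]
      simp only [Matrix.mul_assoc]
      module
    have e2 : Jᴴ * (T * R * Tᴴ * R * T) * J
        = (4 : ℂ) • ((Jᴴ * T * J) * (Jᴴ * Tᴴ * J) * (Jᴴ * T * J)) - (3 : ℂ) • (Jᴴ * T * J) := by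
      have c1 : Jᴴ * (T * J * Jᴴ) * J = Jᴴ * T * J := by
        simp only [Matrix.mul_assoc]; rw [hJ, Matrix.mul_one]
      have c2 : Jᴴ * (J * (Jᴴ * T)) * J = Jᴴ * T * J := by
        rw [← Matrix.mul_assoc Jᴴ J, hJ, Matrix.one_mul]
      rw [e1, Matrix.mul_add, Matrix.mul_sub, Matrix.mul_sub, Matrix.add_mul, Matrix.sub_mul,
        Matrix.sub_mul, Matrix.mul_smul, Matrix.mul_smul, Matrix.mul_smul, Matrix.smul_mul,
        Matrix.smul_mul, Matrix.smul_mul, c1, c2]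
      simp only [Matrix.mul_assoc]
      module
    rw [Matrix.mul_neg, Matrix.neg_mul, e2, hB, hBH]
    simp only [Matrix.smul_mul, Matrix.mul_smul, smul_smul]
    module
  have hE1 := norm_unitary_le_one hE
  have hB2 : ‖B‖ ≤ 2 := by
    have : B = (B - E) + E := by abel
    rw [this]; exact (norm_add_le _ _).trans (by linarith)
  have hBEH : ‖(B - E)ᴴ‖ ≤ η := (Matrix.l2_opNorm_conjTranspose _).trans_le h
  have hBH2 : ‖Bᴴ‖ ≤ 2 := (Matrix.l2_opNorm_conjTranspose _).trans_le hB2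
  have hcube : ‖B * Bᴴ * B - E‖ ≤ 7 * η := by
    have e : B * Bᴴ * B - E = (B - E) * Bᴴ * B + E * (B - E)ᴴ * B + (B - E) := by
      simp only [Matrix.conjTranspose_sub, Matrix.sub_mul, Matrix.mul_sub, hEE, Matrix.one_mul]
      abel
    rw [e]
    have f1 := norm_mul_le_of_norm_le_one (norm_mul_le_of_norm_le_one h hBH2) hB2
    have f2 := norm_mul_le_of_norm_le_one (norm_mul_le_of_norm_le_one hE1 hBEH) hB2
    refine (norm_add₃_le).trans ?_
    linarith
  refine (norm_sq_sub_le_of_block hQ hJ hE (ξ := 5 * η) ?_).trans (by linarith)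
  have e : (3 / 2 : ℂ) • B - (1 / 2 : ℂ) • (B * Bᴴ * B) - E
      = (3 / 2 : ℂ) • (B - E) - (1 / 2 : ℂ) • (B * Bᴴ * B - E) := by module
  rw [hX, e]
  refine (norm_sub_le _ _).trans ?_
  rw [norm_smul, norm_smul]
  norm_num
  linarith

end Amplify

/-! ### Exponentials of matrices -/

section Exponential

variable {Y Z : Type} [Fintype Y] [DecidableEq Y] [Fintype Z] [DecidableEq Z]

lemma exp_mul_eq_mul_exp {Θ : Matrix Y Y ℂ} {J : Matrix Y Z ℂ} {h : Matrix Z Z ℂ}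
    (hJ : Θ * J = J * h) : NormedSpace.exp Θ * J = J * NormedSpace.exp h := by
  have hp : ∀ n : ℕ, Θ ^ n * J = J * h ^ n := by
    intro n
    induction n with
    | zero => simp
    | succ n ih => rw [pow_succ, Matrix.mul_assoc, hJ, ← Matrix.mul_assoc, ih, Matrix.mul_assoc,
        ← pow_succ]
  have h1 := NormedSpace.exp_series_hasSum_exp' (𝕂 := ℂ) Θ
  have h2 := NormedSpace.exp_series_hasSum_exp' (𝕂 := ℂ) h
  have h1' := h1.map (⟨⟨fun T => T * J, Matrix.zero_mul J⟩, fun S T => Matrix.add_mul S T J⟩ :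
    Matrix Y Y ℂ →+ Matrix Y Z ℂ) (continuous_id.matrix_mul continuous_const)
  have h2' := h2.map (⟨⟨fun T => J * T, Matrix.mul_zero J⟩, fun S T => Matrix.mul_add J S T⟩ :
    Matrix Z Z ℂ →+ Matrix Y Z ℂ) (continuous_const.matrix_mul continuous_id)
  refine h1'.unique ?_
  convert h2' using 2
  · funext n
    simp [hp]
  · rfl

lemma exp_unitary {H : Matrix Y Y ℂ} (hH : H.IsHermitian) (t : ℝ) :
    NormedSpace.exp ((-(Complex.I * (t : ℂ))) • H) ∈ Matrix.unitaryGroup Y ℂ := by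
  set A := (-(Complex.I * (t : ℂ))) • H with hA
  have hs : Aᴴ = -A := by
    rw [hA, Matrix.conjTranspose_smul, hH.eq]; simp
  rw [Matrix.mem_unitaryGroup_iff, Matrix.star_eq_conjTranspose, ← Matrix.exp_conjTranspose, hs,
    ← Matrix.exp_add_of_commute _ _ (Commute.neg_right (Commute.refl A)), add_neg_cancel,
    NormedSpace.exp_zero]

lemma norm_exp_sub_exp_le {H H' : Matrix Y Y ℂ} (hH : H.IsHermitian) (hH' : H'.IsHermitian)
    {t : ℝ} (ht : 0 ≤ t) :
    ‖NormedSpace.exp ((-(Complex.I * (t : ℂ))) • H)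
      - NormedSpace.exp ((-(Complex.I * (t : ℂ))) • H')‖ ≤ t * ‖H - H'‖ := by
  set A := (-Complex.I) • H with hA
  set A' := (-Complex.I) • H' with hA'
  have eA : ∀ s : ℝ, (-(Complex.I * (s : ℂ))) • H = s • A := fun s => by
    rw [hA, ← Complex.coe_smul, smul_smul]; congr 1; ring
  have eA' : ∀ s : ℝ, (-(Complex.I * (s : ℂ))) • H' = s • A' := fun s => by
    rw [hA', ← Complex.coe_smul, smul_smul]; congr 1; ring
  have u : ∀ s : ℝ, ‖NormedSpace.exp (s • A)‖ ≤ 1 := fun s => by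
    rw [← eA]; exact norm_unitary_le_one (exp_unitary hH s)
  have u' : ∀ s : ℝ, ‖NormedSpace.exp (s • A')‖ ≤ 1 := fun s => by
    rw [← eA']; exact norm_unitary_le_one (exp_unitary hH' s)
  have hd : ∀ s : ℝ, HasDerivAt
      (fun s : ℝ => NormedSpace.exp (s • (-A')) * NormedSpace.exp (s • A))
      (NormedSpace.exp (s • (-A')) * (A - A') * NormedSpace.exp (s • A)) s := by
    intro s
    have h1 := hasDerivAt_exp_smul_const (𝕂 := ℝ) (-A') s
    have h2 := hasDerivAt_exp_smul_const' (𝕂 := ℝ) A s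
    refine (h1.mul h2).congr_deriv ?_
    simp only [Matrix.mul_assoc, mul_sub, sub_mul, mul_neg, neg_mul]
    abel
  have hm := norm_image_sub_le_of_norm_deriv_le_segment'
    (f := fun s : ℝ => NormedSpace.exp (s • (-A')) * NormedSpace.exp (s • A))
    (f' := fun s => NormedSpace.exp (s • (-A')) * (A - A') * NormedSpace.exp (s • A))
    (a := 0) (b := t) (C := ‖H - H'‖) (fun s _ => (hd s).hasDerivWithinAt) ?_ t
    (Set.right_mem_Icc.2 ht)
  · have hinv : NormedSpace.exp (t • A') * NormedSpace.exp (t • (-A')) = 1 := by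
      rw [smul_neg, ← Matrix.exp_add_of_commute _ _ (Commute.neg_right (Commute.refl (t • A'))),
        add_neg_cancel, NormedSpace.exp_zero]
    have e : NormedSpace.exp (t • A) - NormedSpace.exp (t • A') = NormedSpace.exp (t • A')
        * (NormedSpace.exp (t • (-A')) * NormedSpace.exp (t • A)
          - NormedSpace.exp ((0 : ℝ) • (-A')) * NormedSpace.exp ((0 : ℝ) • A)) := by
      rw [mul_sub, ← mul_assoc, hinv]
      simp
    rw [eA, eA', e]
    have := norm_mul_le_of_norm_le_one (u' t) hm
    simp only [sub_zero] at this
    linarith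
  · intro s _
    have e : ‖A - A'‖ = ‖H - H'‖ := by
      rw [hA, hA', ← smul_sub, norm_smul]; simp
    have := norm_mul_le_of_norm_le_one (norm_mul_le_of_norm_le_one
      (show ‖NormedSpace.exp (s • (-A'))‖ ≤ 1 by
        rw [smul_neg, ← neg_smul]; exact u' (-s)) e.le) (u s)
    simpa using this

lemma norm_taylor_sub_exp_le {A : Matrix Y Y ℂ} (hA : ‖A‖ ≤ 1 / 2) (K : ℕ) :
    ‖∑ j ∈ Finset.range (K + 1), ((j.factorial : ℂ)⁻¹) • A ^ j - NormedSpace.exp A‖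
      ≤ (1 / 2) ^ K := by
  have h := norm_sub_le_of_geometric_bound_of_hasSum (C := 1) (r := 1 / 2) (by norm_num)
    (f := fun j => ((j.factorial : ℂ)⁻¹) • A ^ j) ?_
    (NormedSpace.exp_series_hasSum_exp' (𝕂 := ℂ) A) (K + 1)
  · refine h.trans (le_of_eq ?_)
    rw [pow_succ]; norm_num
  · intro n
    have h1 : ‖A ^ n‖ ≤ (1 / 2) ^ n := by
      rcases Nat.eq_zero_or_pos n with rfl | hn
      · simpa using norm_unitary_le_one (one_mem (Matrix.unitaryGroup Y ℂ))
      · exact (norm_pow_le' A hn).trans (pow_le_pow_left₀ (norm_nonneg _) hA n)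
    rw [norm_smul, one_mul, norm_inv, Complex.norm_natCast]
    have h2 : ((n.factorial : ℝ))⁻¹ ≤ 1 :=
      inv_le_one_of_one_le₀ (by exact_mod_cast n.factorial_pos)
    exact (mul_le_of_le_one_left (norm_nonneg _) h2).trans h1

end Exponential

/-! ### Trace distance of pure states -/

section TraceDist

open scoped ComplexOrder

variable {R : Type} [Fintype R] [DecidableEq R]

lemma traceNorm_sq_le {A : Matrix R R ℂ} {q : ℝ} (hr : A.rank ≤ 2)
    (hq : (Aᴴ * A).trace.re = q) : traceNorm A ^ 2 ≤ 2 * q := by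
  set hA := Matrix.isHermitian_conjTranspose_mul_self A
  have hpos : ∀ i, 0 ≤ hA.eigenvalues i :=
    (Matrix.posSemidef_conjTranspose_mul_self A).eigenvalues_nonneg
  have hsum : ∑ i, hA.eigenvalues i = q := by
    have := hA.trace_eq_sum_eigenvalues
    rw [← hq, this]
    simp
  have hcard : (Finset.univ.filter fun i => hA.eigenvalues i ≠ 0).card ≤ 2 := by
    rw [← Fintype.card_subtype, ← hA.rank_eq_card_non_zero_eigs,
      Matrix.rank_conjTranspose_mul_self]
    exact hr
  have h1 : traceNorm A
      = ∑ i ∈ Finset.univ.filter (fun i => hA.eigenvalues i ≠ 0), Real.sqrt (hA.eigenvalues i) := by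
    rw [traceNorm, Finset.sum_filter_of_ne]
    intro i _ h h0
    simp [h0] at h
  rw [h1]
  refine (sq_sum_le_card_mul_sum_sq).trans ?_
  simp only [Real.sq_sqrt (hpos _)]
  have hle : ∑ i ∈ Finset.univ.filter (fun i => hA.eigenvalues i ≠ 0), hA.eigenvalues i ≤ q := by
    rw [← hsum]
    exact Finset.sum_le_sum_of_subset_of_nonneg (Finset.filter_subset _ _) fun i _ _ => hpos i
  have hc : ((Finset.univ.filter fun i => hA.eigenvalues i ≠ 0).card : ℝ) ≤ 2 := by
    exact_mod_cast hcard
  refine mul_le_mul hc hle ?_ zero_le_two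
  exact Finset.sum_nonneg fun i _ => hpos i

/-- The trace distance of the pure states of unit vectors `v` and `w` is at most
`√(1 - |⟨v, w⟩|²)`. -/
lemma traceDist_pureState_sq_le {v w : R → ℂ} (hv : star v ⬝ᵥ v = 1) (hw : star w ⬝ᵥ w = 1) :
    traceDist (pureState v) (pureState w) ^ 2 ≤ 1 - ‖star v ⬝ᵥ w‖ ^ 2 := by
  have hr : (pureState v - pureState w).rank ≤ 2 := by
    have e : pureState v - pureState w = Matrix.of (fun r => ![v r, w r])
        * Matrix.of ![star v, -star w] := by
      ext i j
      simp [pureState, Matrix.mul_apply, Matrix.vecMulVec_apply, sub_eq_add_neg]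
    rw [e]
    refine (Matrix.rank_mul_le_left _ _).trans ((Matrix.rank_le_card_width _).trans ?_)
    simp
  have hH : (pureState v - pureState w)ᴴ = pureState v - pureState w := by
    simp [pureState, Matrix.conjTranspose_sub, Matrix.conjTranspose_vecMulVec]
  have hq : ((pureState v - pureState w)ᴴ * (pureState v - pureState w)).trace.re
      = 2 * (1 - ‖star v ⬝ᵥ w‖ ^ 2) := by
    have hwv : star w ⬝ᵥ v = star (star v ⬝ᵥ w) := by
      rw [Matrix.star_dotProduct]
    have hvv' : v ⬝ᵥ star v = 1 := by rw [dotProduct_comm, hv]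
    have hww' : w ⬝ᵥ star w = 1 := by rw [dotProduct_comm, hw]
    have hvw' : v ⬝ᵥ star w = star (star v ⬝ᵥ w) := by rw [dotProduct_comm, hwv]
    have hwv' : w ⬝ᵥ star v = star v ⬝ᵥ w := by rw [dotProduct_comm]
    rw [hH]
    simp only [pureState, Matrix.sub_mul, Matrix.mul_sub, Matrix.vecMulVec_mul_vecMulVec,
      Matrix.trace_sub, Matrix.trace_vecMulVec, hv, hw, hwv, dotProduct_smul, smul_eq_mul,
      hvv', hww', hvw', hwv']
    have h1 : ∀ z : ℂ, z * star z = ((‖z‖ ^ 2 : ℝ) : ℂ) := fun z => by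
      rw [Complex.star_def, Complex.mul_conj, Complex.normSq_eq_norm_sq]
    rw [mul_comm (star _), h1]
    simp only [Complex.sub_re, Complex.ofReal_re, mul_one, Complex.one_re]
    ring
  have := traceNorm_sq_le hr hq
  rw [traceDist, div_pow]
  linarith

lemma traceDist_pureState_le_one {v w : R → ℂ} (hv : star v ⬝ᵥ v = 1) (hw : star w ⬝ᵥ w = 1) :
    traceDist (pureState v) (pureState w) ≤ 1 := by
  have := traceDist_pureState_sq_le hv hw
  nlinarith [sq_nonneg ‖star v ⬝ᵥ w‖]

lemma traceDist_pureState_le_norm {v w : R → ℂ} (hv : star v ⬝ᵥ v = 1) (hw : star w ⬝ᵥ w = 1) :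
    traceDist (pureState v) (pureState w) ≤ ‖WithLp.toLp 2 (v - w)‖ := by
  have h := traceDist_pureState_sq_le hv hw
  have hn : ‖WithLp.toLp 2 (v - w)‖ ^ 2 = 2 - 2 * (star v ⬝ᵥ w).re := by
    have : ((‖WithLp.toLp 2 (v - w)‖ ^ 2 : ℝ) : ℂ) = star (v - w) ⬝ᵥ (v - w) := by
      rw [EuclideanSpace.norm_sq_eq, dotProduct]
      push_cast
      refine Finset.sum_congr rfl fun i _ => ?_
      simp [← Complex.conj_mul']
    have h2 := congrArg Complex.re this
    rw [Complex.ofReal_re] at h2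
    have hwv : star w ⬝ᵥ v = star (star v ⬝ᵥ w) := by
      rw [Matrix.star_dotProduct]
    rw [h2, star_sub, sub_dotProduct, dotProduct_sub, dotProduct_sub, hv, hw, hwv]
    simp
    ring
  have hz := Complex.re_le_norm (star v ⬝ᵥ w)
  have h0 : 0 ≤ ‖star v ⬝ᵥ w‖ := norm_nonneg _
  refine le_of_sq_le_sq ?_ (norm_nonneg _)
  rw [hn]
  nlinarith [sq_nonneg (1 - ‖star v ⬝ᵥ w‖)]

end TraceDist

/-! ### Circuits as operator-valued functions of the black box -/

/-- `IsCircuit n D`: the matrix-valued function `D` of the black-box unitary is a product of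
unitary gates and `n` calls to the black box or its inverse. The gates act on an arbitrary finite
register with basis labels `X` next to the register `Q` of the black box. -/
inductive IsCircuit {X Q : Type} [Fintype X] [DecidableEq X] [Fintype Q] [DecidableEq Q] :
    ℕ → (Matrix Q Q ℂ → Matrix (X × Q) (X × Q) ℂ) → Prop
  | gate (V : Matrix (X × Q) (X × Q) ℂ) (hV : V ∈ Matrix.unitaryGroup (X × Q) ℂ) :
      IsCircuit 0 fun _ => V
  | call : IsCircuit 1 fun U => (1 : Matrix X X ℂ) ⊗ₖ U
  | callInv : IsCircuit 1 fun U => (1 : Matrix X X ℂ) ⊗ₖ Uᴴ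
  | mul {m n : ℕ} {D D' : Matrix Q Q ℂ → Matrix (X × Q) (X × Q) ℂ} :
      IsCircuit m D → IsCircuit n D' → IsCircuit (m + n) fun U => D U * D' U

section IsCircuit

variable {X Q : Type} [Fintype X] [DecidableEq X] [Fintype Q] [DecidableEq Q]

lemma IsCircuit.conjTranspose {n : ℕ} {D : Matrix Q Q ℂ → Matrix (X × Q) (X × Q) ℂ}
    (h : IsCircuit n D) : IsCircuit n fun U => (D U)ᴴ := by
  induction h with
  | gate V hV => exact .gate _ (unitary_conjTranspose hV)
  | call => simpa [Matrix.conjTranspose_kronecker] using IsCircuit.callInv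
  | callInv => simpa [Matrix.conjTranspose_kronecker] using IsCircuit.call
  | mul _ _ ih ih' =>
    rw [add_comm]
    simpa [Matrix.conjTranspose_mul] using ih'.mul ih

lemma IsCircuit.unitary {n : ℕ} {D : Matrix Q Q ℂ → Matrix (X × Q) (X × Q) ℂ}
    (h : IsCircuit n D) {U : Matrix Q Q ℂ} (hU : U ∈ Matrix.unitaryGroup Q ℂ) :
    D U ∈ Matrix.unitaryGroup (X × Q) ℂ := by
  induction h with
  | gate V hV => exact hV
  | call => exact Matrix.kronecker_mem_unitary (one_mem _) hU
  | callInv => exact Matrix.kronecker_mem_unitary (one_mem _) (unitary_conjTranspose hU)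
  | mul _ _ ih ih' => exact mul_mem ih ih'

lemma circuitOp_append {S : Type} [Fintype S] [DecidableEq S] {w : ℕ} (U : Matrix Q Q ℂ)
    (c c' : List (Step S w Q)) : circuitOp U (c ++ c') = circuitOp U c' * circuitOp U c := by
  induction c with
  | nil => simp [circuitOp]
  | cons s c ih => simp [circuitOp, ih, Matrix.mul_assoc]

/-- A relabelling of the registers turns a circuit into a list of steps. -/
lemma IsCircuit.exists_list {S : Type} [Fintype S] [DecidableEq S] {w : ℕ}
    (e : X ≃ S × Fin (w + 1)) {n : ℕ} {D : Matrix Q Q ℂ → Matrix (X × Q) (X × Q) ℂ}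
    (h : IsCircuit n D) : ∃ c : List (Step S w Q), numCalls c = n ∧
      ∀ U, circuitOp U c = Matrix.reindex (e.prodCongr (Equiv.refl Q)) (e.prodCongr (Equiv.refl Q))
        (D U) := by
  have hk : ∀ U : Matrix Q Q ℂ, (1 : Matrix (S × Fin (w + 1)) (S × Fin (w + 1)) ℂ) ⊗ₖ U
      = Matrix.reindex (e.prodCongr (Equiv.refl Q)) (e.prodCongr (Equiv.refl Q))
        ((1 : Matrix X X ℂ) ⊗ₖ U) := by
    intro U
    ext ⟨a, q⟩ ⟨b, q'⟩
    simp [Matrix.kroneckerMap_apply, Matrix.one_apply]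
  induction h with
  | gate V hV =>
    refine ⟨[.gate ⟨Matrix.reindex (e.prodCongr (Equiv.refl Q)) (e.prodCongr (Equiv.refl Q)) V,
      ?_⟩], by simp [numCalls, Step.calls], fun U => by simp [circuitOp, Step.op]⟩
    rw [Matrix.mem_unitaryGroup_iff, Matrix.star_eq_conjTranspose, Matrix.conjTranspose_reindex,
      Matrix.reindex_apply, Matrix.reindex_apply, Matrix.submatrix_mul_equiv,
      ← Matrix.star_eq_conjTranspose, Matrix.mem_unitaryGroup_iff.1 hV, Matrix.submatrix_one_equiv]
  | call => exact ⟨[.call], by simp [numCalls, Step.calls],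
      fun U => by simp only [circuitOp, Step.op, one_mul, hk]⟩
  | callInv => exact ⟨[.callInv], by simp [numCalls, Step.calls],
      fun U => by simp only [circuitOp, Step.op, one_mul, hk]⟩
  | mul _ _ ih ih' =>
    obtain ⟨c, hc, hc'⟩ := ih
    obtain ⟨c', hc1, hc1'⟩ := ih'
    refine ⟨c' ++ c, by simp [numCalls] at hc hc1 ⊢; omega, fun U => ?_⟩
    rw [circuitOp_append, hc', hc1']
    simp only [Matrix.reindex_apply, Matrix.submatrix_mul_equiv]

end IsCircuit

/-! ### Controlled gates indexed by classical data -/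

section Ctrl

variable {K B : Type} [Fintype K] [DecidableEq K] [Fintype B] [DecidableEq B]

/-- The matrix `|k⟩|q⟩ ↦ |π k⟩ (g k |q⟩)`: a permutation `π` of classical data, together with an
operator `g k` on a register `B` that is controlled by these data. -/
def ctrlMat (π : Equiv.Perm K) (g : K → Matrix B B ℂ) : Matrix (K × B) (K × B) ℂ :=
  Matrix.of fun a b => if a.1 = π b.1 then g b.1 a.2 b.2 else 0

lemma ctrlMat_apply (π : Equiv.Perm K) (g : K → Matrix B B ℂ) (a b : K × B) :
    ctrlMat π g a b = if a.1 = π b.1 then g b.1 a.2 b.2 else 0 := rfl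

lemma ctrlMat_mul (π π' : Equiv.Perm K) (g g' : K → Matrix B B ℂ) :
    ctrlMat π g * ctrlMat π' g' = ctrlMat (π * π') fun k => g (π' k) * g' k := by
  ext ⟨k, q⟩ ⟨k', q'⟩
  simp only [Matrix.mul_apply, ctrlMat_apply, Fintype.sum_prod_type, Equiv.Perm.mul_apply]
  rw [Finset.sum_eq_single (π' k')]
  · by_cases h : k = π (π' k') <;> simp [h]
  · intro l _ hl; simp [hl]
  · simp

lemma ctrlMat_one : ctrlMat (1 : Equiv.Perm K) (fun _ => (1 : Matrix B B ℂ)) = 1 := by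
  ext ⟨k, q⟩ ⟨k', q'⟩
  simp only [ctrlMat_apply, Matrix.one_apply, Prod.mk.injEq, Equiv.Perm.one_apply]
  split_ifs <;> simp_all

lemma ctrlMat_conjTranspose (π : Equiv.Perm K) (g : K → Matrix B B ℂ) :
    (ctrlMat π g)ᴴ = ctrlMat π⁻¹ fun k => (g (π⁻¹ k))ᴴ := by
  ext ⟨k, q⟩ ⟨k', q'⟩
  simp only [ctrlMat_apply, Matrix.conjTranspose_apply]
  by_cases h : k' = π k
  · subst h; simp
  · have h' : k ≠ π⁻¹ k' := fun h' => h (by rw [h']; simp)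
    rw [if_neg h, if_neg h', star_zero]

lemma ctrlMat_unitary (π : Equiv.Perm K) {g : K → Matrix B B ℂ}
    (hg : ∀ k, g k ∈ Matrix.unitaryGroup B ℂ) :
    ctrlMat π g ∈ Matrix.unitaryGroup (K × B) ℂ := by
  rw [Matrix.mem_unitaryGroup_iff', Matrix.star_eq_conjTranspose, ctrlMat_conjTranspose,
    ctrlMat_mul, ← ctrlMat_one]
  congr 1
  · simp
  · funext k
    have := Matrix.mem_unitaryGroup_iff'.1 (hg k)
    simpa [Matrix.star_eq_conjTranspose] using this

end Ctrl

/-! ### Operators that can be implemented with black-box calls -/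

section Implementable

variable {M d : ℕ} {E G X Y Z : Type} [Fintype E] [DecidableEq E] [Fintype G] [DecidableEq G]
  [Fintype X] [DecidableEq X] [Fintype Y] [DecidableEq Y] [Fintype Z] [DecidableEq Z]

/-- `Implementable g₀ b₀ ι n T`: on the subspace spanned by the basis states `ι y`, a circuit with
`n` calls acts as the operator `T f`, for every function `f` and every unitary that computes `f`.
Blank registers are part of the embedding `ι`. -/
def Implementable (g₀ : G) (b₀ : Fin M × E) (ι : Y → X × QueryReg M d E G) (n : ℕ)
    (T : (Fin M × Fin d → Fin M × E) → Matrix Y Y ℂ) : Prop :=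
  ∃ D : Matrix (QueryReg M d E G) (QueryReg M d E G) ℂ →
      Matrix (X × QueryReg M d E G) (X × QueryReg M d E G) ℂ,
    IsCircuit n D ∧ ∀ f, ∀ U ∈ Matrix.unitaryGroup (QueryReg M d E G) ℂ,
      Implements g₀ b₀ f U → D U * inj ι = inj ι * T f

variable {g₀ : G} {b₀ : Fin M × E} {ι : Y → X × QueryReg M d E G}

lemma Implementable.gate (hι : Function.Injective ι) {V : Matrix Y Y ℂ}
    (hV : V ∈ Matrix.unitaryGroup Y ℂ) : Implementable g₀ b₀ ι 0 fun _ => V := by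
  obtain ⟨W, hW, hW'⟩ := exists_unitary_mul_inj hι (A := inj ι * V) (by
    rw [Matrix.conjTranspose_mul, Matrix.mul_assoc, ← Matrix.mul_assoc _ (inj ι), inj_isometry hι,
      Matrix.one_mul, ← Matrix.star_eq_conjTranspose, Matrix.mem_unitaryGroup_iff'.1 hV])
  exact ⟨_, .gate W hW, fun _ _ _ _ => hW'⟩

lemma Implementable.mul {m n : ℕ} {T T' : (Fin M × Fin d → Fin M × E) → Matrix Y Y ℂ}
    (h : Implementable g₀ b₀ ι m T) (h' : Implementable g₀ b₀ ι n T') :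
    Implementable g₀ b₀ ι (m + n) fun f => T f * T' f := by
  obtain ⟨D, hD, hD1⟩ := h
  obtain ⟨D', hD', hD1'⟩ := h'
  refine ⟨_, hD.mul hD', fun f U hU hf => ?_⟩
  rw [Matrix.mul_assoc, hD1' f U hU hf, ← Matrix.mul_assoc, hD1 f U hU hf, Matrix.mul_assoc]

lemma Implementable.pow (hι : Function.Injective ι) {n : ℕ}
    {T : (Fin M × Fin d → Fin M × E) → Matrix Y Y ℂ}
    (h : Implementable g₀ b₀ ι n T) (r : ℕ) :
    Implementable g₀ b₀ ι (r * n) fun f => T f ^ r := by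
  induction r with
  | zero => simpa using Implementable.gate hι (one_mem _)
  | succ r ih => simpa only [add_mul, one_mul, pow_succ] using ih.mul h

lemma Implementable.conjTranspose {n : ℕ}
    {T : (Fin M × Fin d → Fin M × E) → Matrix Y Y ℂ}
    (hT : ∀ f, T f ∈ Matrix.unitaryGroup Y ℂ) (h : Implementable g₀ b₀ ι n T) :
    Implementable g₀ b₀ ι n fun f => (T f)ᴴ := by
  obtain ⟨D, hD, hD1⟩ := h
  refine ⟨_, hD.conjTranspose, fun f U hU hf => ?_⟩
  have h1 := Matrix.mem_unitaryGroup_iff'.1 (hD.unitary hU)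
  have h2 := Matrix.mem_unitaryGroup_iff.1 (hT f)
  rw [Matrix.star_eq_conjTranspose] at h1 h2
  calc (D U)ᴴ * inj ι = (D U)ᴴ * (inj ι * T f) * (T f)ᴴ := by
        rw [Matrix.mul_assoc, Matrix.mul_assoc, h2, Matrix.mul_one]
    _ = inj ι * (T f)ᴴ := by
        rw [← hD1 f U hU hf, ← Matrix.mul_assoc, h1, Matrix.one_mul]

/-- Restriction to a subspace on which further registers are blank. -/
lemma Implementable.restrict {n : ℕ} {T : (Fin M × Fin d → Fin M × E) → Matrix Y Y ℂ}
    {T' : (Fin M × Fin d → Fin M × E) → Matrix Z Z ℂ} {κ : Z → Y}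
    (h : Implementable g₀ b₀ ι n T) (hT : ∀ f, T f * inj κ = inj κ * T' f) :
    Implementable g₀ b₀ (ι ∘ κ) n T' := by
  obtain ⟨D, hD, hD1⟩ := h
  refine ⟨D, hD, fun f U hU hf => ?_⟩
  rw [inj_comp, ← Matrix.mul_assoc, hD1 f U hU hf, Matrix.mul_assoc, hT, Matrix.mul_assoc]

/-- A permutation matrix as a gate. -/
lemma permMatrix_unitary (σ : Equiv.Perm Z) :
    σ.permMatrix ℂ ∈ Matrix.unitaryGroup Z ℂ := by
  rw [Matrix.mem_unitaryGroup_iff, Matrix.star_eq_conjTranspose, Matrix.conjTranspose_permMatrix,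
    ← Matrix.permMatrix_mul]
  simp

lemma kronecker_one_mulVec {Q : Type} [Fintype Q] [DecidableEq Q] (U : Matrix Q Q ℂ) (x : X)
    (φ : Q → ℂ) :
    ((1 : Matrix X X ℂ) ⊗ₖ U) *ᵥ (fun r => if r.1 = x then φ r.2 else 0)
      = fun r => if r.1 = x then (U *ᵥ φ) r.2 else 0 := by
  funext ⟨x', q⟩
  simp only [Matrix.mulVec, dotProduct, Matrix.kroneckerMap_apply, Fintype.sum_prod_type,
    Matrix.one_apply]
  rw [Finset.sum_eq_single x']
  · by_cases h : x' = x <;> simp [h]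
  · intro b _ hb; simp [hb.symm]
  · simp

/-- Two calls suffice to apply a permutation that depends on the value of the black-box function
at an address. One call computes the value, the permutation is controlled by this value, and the
inverse call uncomputes the value and the unknown state `φ`. -/
lemma implementable_query (a₀ : Fin M × Fin d) (addr : X → Fin M × Fin d)
    (e : Fin M × E → Equiv.Perm X) (he : ∀ v x, addr (e v x) = addr x)
    (P : (Fin M × Fin d → Fin M × E) → Matrix X X ℂ)
    (hP : ∀ f x x', P f x' x = if x' = e (f (addr x)) x then 1 else 0) :
    Implementable g₀ b₀ (fun x : X => (x, (((a₀, g₀), b₀) : QueryReg M d E G))) 2 P := by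
  let σ₁ : Equiv.Perm (X × QueryReg M d E G) :=
    { toFun := fun r => (r.1, ((Equiv.swap a₀ (addr r.1) r.2.1.1, r.2.1.2), r.2.2))
      invFun := fun r => (r.1, ((Equiv.swap a₀ (addr r.1) r.2.1.1, r.2.1.2), r.2.2))
      left_inv := fun r => by simp
      right_inv := fun r => by simp }
  -- `permMatrix` acts on vectors by precomposition, so this is the inverse of the permutation
  let σ₂ : Equiv.Perm (X × QueryReg M d E G) :=
    { toFun := fun r => ((e r.2.2).symm r.1, r.2)
      invFun := fun r => (e r.2.2 r.1, r.2)
      left_inv := fun r => by simp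
      right_inv := fun r => by simp }
  refine ⟨_, ((((IsCircuit.gate _ (permMatrix_unitary σ₁)).mul .callInv).mul
    (.gate _ (permMatrix_unitary σ₂))).mul .call).mul (.gate _ (permMatrix_unitary σ₁)), ?_⟩
  rintro f U hU ⟨φ, hφ⟩
  have hU' := Matrix.mem_unitaryGroup_iff'.1 hU
  have hstep₁ : ∀ (x : X) (a b : Fin M × Fin d), Equiv.swap a₀ (addr x) b = a →
      (σ₁.permMatrix ℂ) *ᵥ (fun r => if r.1 = x then
        (Pi.single ((a, g₀), b₀) 1 : QueryReg M d E G → ℂ) r.2 else 0)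
      = fun r => if r.1 = x then (Pi.single ((b, g₀), b₀) 1 : QueryReg M d E G → ℂ) r.2 else 0 := by
    rintro x a b rfl
    rw [Matrix.permMatrix_mulVec]
    funext ⟨x', ⟨a', g⟩, b'⟩
    by_cases h : x' = x
    · subst h
      simp [σ₁, Pi.single_apply]
    · simp [σ₁, h]
  have key : ∀ x : X, (((((σ₁.permMatrix ℂ) * ((1 : Matrix X X ℂ) ⊗ₖ Uᴴ)) * σ₂.permMatrix ℂ)
      * ((1 : Matrix X X ℂ) ⊗ₖ U)) * σ₁.permMatrix ℂ) *ᵥ (fun r => if r.1 = x then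
        (Pi.single ((a₀, g₀), b₀) 1 : QueryReg M d E G → ℂ) r.2 else 0)
      = fun r => if r.1 = e (f (addr x)) x then
        (Pi.single ((a₀, g₀), b₀) 1 : QueryReg M d E G → ℂ) r.2 else 0 := by
    intro x
    set y := e (f (addr x)) x with hy
    have hU1 : Uᴴ *ᵥ (fun r => if r.2 = f (addr x) then φ (addr x) r.1 else 0)
        = Pi.single ((addr x, g₀), b₀) 1 := by
      have h1 : (fun r : QueryReg M d E G => if r.2 = f (addr x) then φ (addr x) r.1 else 0)
          = U *ᵥ Pi.single ((addr x, g₀), b₀) 1 := funext fun r => (hφ _ r).symm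
      rw [h1, Matrix.mulVec_mulVec, ← Matrix.star_eq_conjTranspose, hU', Matrix.one_mulVec]
    have hstep₂ : (σ₂.permMatrix ℂ) *ᵥ (fun r => if r.1 = x then
          (U *ᵥ Pi.single ((addr x, g₀), b₀) 1) r.2 else 0)
        = fun r => if r.1 = y then
          (fun r : QueryReg M d E G => if r.2 = f (addr x) then φ (addr x) r.1 else 0) r.2
          else 0 := by
      rw [Matrix.permMatrix_mulVec]
      funext ⟨x', r⟩
      simp only [Function.comp_apply, hφ]
      by_cases h : r.2 = f (addr x)
      · simp only [σ₂, Equiv.coe_fn_mk, h, Equiv.symm_apply_eq, hy]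
      · simp [σ₂, h]
    simp only [← Matrix.mulVec_mulVec]
    rw [hstep₁ x a₀ (addr x) (by simp), kronecker_one_mulVec, hstep₂,
      kronecker_one_mulVec Uᴴ y (fun r : QueryReg M d E G =>
        if r.2 = f (addr x) then φ (addr x) r.1 else 0), hU1,
      hstep₁ y (addr x) a₀ (by rw [hy, he]; simp)]
  ext r x
  have h1 := congrFun (key x) r
  rw [Matrix.mul_apply]
  rw [Matrix.mulVec, dotProduct] at h1
  have h2 : ∀ s : X × QueryReg M d E G,
      (inj (fun x : X => (x, (((a₀, g₀), b₀) : QueryReg M d E G))) : Matrix _ X ℂ) s x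
      = if s.1 = x then (Pi.single ((a₀, g₀), b₀) 1 : QueryReg M d E G → ℂ) s.2 else 0 := by
    intro s
    simp only [inj_apply, Prod.ext_iff (x := s), Pi.single_apply, ite_and]
  simp only [h2]
  rw [h1, Matrix.mul_apply]
  simp only [inj_apply, hP]
  obtain ⟨x', q⟩ := r
  rw [Finset.sum_eq_single x']
  · rw [Pi.single_apply]
    by_cases h : q = ((a₀, g₀), b₀) <;> simp [h]
  · intro b _ hb; simp [Ne.symm hb]
  · simp

end Implementable

/-! ### The quantum walk of a sparse Hamiltonian -/

/-- The unitary `2 × 2` matrix with entry `c` in the corner, for `‖c‖ ≤ 1`. -/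
def dilate (c : ℂ) : Matrix Bool Bool ℂ :=
  Matrix.of fun a b => match a, b with
    | false, false => c
    | false, true => (Real.sqrt (1 - ‖c‖ ^ 2) : ℂ)
    | true, false => (Real.sqrt (1 - ‖c‖ ^ 2) : ℂ)
    | true, true => -(starRingEnd ℂ) c

lemma dilate_conjTranspose (c : ℂ) : (dilate c)ᴴ = dilate ((starRingEnd ℂ) c) := by
  ext a b
  cases a <;> cases b <;> simp [dilate]

lemma dilate_conj_mul {c : ℂ} (hc : ‖c‖ ≤ 1) : dilate ((starRingEnd ℂ) c) * dilate c = 1 := by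
  have h0 : 0 ≤ 1 - ‖c‖ ^ 2 := by nlinarith [norm_nonneg c]
  have h1 : (Real.sqrt (1 - ‖c‖ ^ 2) : ℂ) * (Real.sqrt (1 - ‖c‖ ^ 2) : ℂ) = 1 - (‖c‖ : ℂ) ^ 2 := by
    rw [← Complex.ofReal_mul, Real.mul_self_sqrt h0]; push_cast; ring
  have h2 := Complex.conj_mul' c
  have h3 := Complex.mul_conj' c
  ext a b
  cases a <;> cases b <;> simp [dilate, Matrix.mul_apply, h1, h2, h3] <;> ring

lemma dilate_unitary {c : ℂ} (hc : ‖c‖ ≤ 1) : dilate c ∈ Matrix.unitaryGroup Bool ℂ := by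
  rw [Matrix.mem_unitaryGroup_iff', Matrix.star_eq_conjTranspose, dilate_conjTranspose,
    dilate_conj_mul hc]

/-- A permutation that acts on a part of the data controlled by an address, which it keeps. -/
def addressedPerm {K A : Type} (addr : K → A) (e : A → Equiv.Perm K)
    (he : ∀ a k, addr (e a k) = addr k) : Equiv.Perm K where
  toFun k := e (addr k) k
  invFun k := (e (addr k)).symm k
  left_inv k := by simp [he]
  right_inv k := by
    have : addr ((e (addr k)).symm k) = addr k := by
      have := he (addr k) ((e (addr k)).symm k)
      rwa [Equiv.apply_symm_apply, eq_comm] at this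
    simp [this]

section Walk

variable {M d : ℕ} {E : Type}

/-- The data `(x, i, j)` of the walk: a row `x`, the index `i` of a neighbour `y` of `x`, and an
index `j` that is a guess for the index of `x` among the neighbours of `y`. -/
abbrev Arc (M d : ℕ) : Type := Fin M × Fin d × Fin d

/-- An arc `(x, i, j)` with values `v = f (x, i)` and `v' = f (y, j)`, where `y` is the position
in `v`. -/
abbrev LoadedArc (M d : ℕ) (E : Type) : Type := Arc M d × (Fin M × E) × (Fin M × E)

/-- The values `v = f (x, i)` and `v' = f (y, j)` of an arc. -/
def load (f : Fin M × Fin d → Fin M × E) (k : Arc M d) : LoadedArc M d E :=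
  (k, f (k.1, k.2.1), f ((f (k.1, k.2.1)).1, k.2.2))

/-- The guess `j` is right. If `x` is its own neighbour, the guess is also required to be
`j = i`, because the padding of the black-box function points from `x` to `x` as well. -/
def IsMatched (z : LoadedArc M d E) : Prop :=
  z.2.2.1 = z.1.1 ∧ (z.2.1.1 = z.1.1 → z.1.2.1 = z.1.2.2)

instance (z : LoadedArc M d E) : Decidable (IsMatched z) := by
  unfold IsMatched; infer_instance

/-- Reversal of an arc: `(x, i, j)` and `(y, j, i)` are interchanged if the guess is right. -/
def reverse (z : LoadedArc M d E) : LoadedArc M d E :=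
  if IsMatched z then ((z.2.1.1, z.1.2.2, z.1.2.1), z.2.2, z.2.1) else z

lemma isMatched_reverse (z : LoadedArc M d E) : IsMatched (reverse z) ↔ IsMatched z := by
  unfold reverse
  split_ifs with h
  · simp only [IsMatched, true_and] at h ⊢
    exact ⟨fun _ => h, fun _ h' => (h.2 (by rw [← h', h.1])).symm⟩
  · rfl

lemma reverse_involutive : Function.Involutive (reverse (M := M) (d := d) (E := E)) := by
  intro z
  by_cases h : IsMatched z
  · have h' := (isMatched_reverse z).2 h
    rw [reverse, if_pos h']
    obtain ⟨⟨x, i, j⟩, v, v'⟩ := z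
    have h1 : v'.1 = x := h.1
    simp [reverse, h, h1]
  · have h' := (isMatched_reverse z).not.2 h
    rw [reverse, if_neg h']
    simp [reverse, h]

lemma reverse_load (f : Fin M × Fin d → Fin M × E) (k : Arc M d) :
    reverse (load f k) = load f (reverse (load f k)).1 := by
  by_cases h : IsMatched (load f k)
  · have h1 := h.1
    simp only [load] at h1
    simp only [reverse, if_pos h]
    simp only [load, h1]
  · have e : reverse (load f k) = load f k := if_neg h
    rw [e]
    rfl

/-- Reversal of the arcs, for a black-box function `f`. -/
def arcPerm (f : Fin M × Fin d → Fin M × E) : Equiv.Perm (Arc M d) :=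
  Function.Involutive.toPerm (fun k => (reverse (load f k)).1) fun k => by
    change (reverse (load f (reverse (load f k)).1)).1 = k
    rw [← reverse_load, reverse_involutive]
    rfl

lemma arcPerm_apply (f : Fin M × Fin d → Fin M × E) (k : Arc M d) :
    arcPerm f k = (reverse (load f k)).1 := rfl

lemma arcPerm_arcPerm (f : Fin M × Fin d → Fin M × E) (k : Arc M d) :
    arcPerm f (arcPerm f k) = k :=
  Function.Involutive.toPerm_involutive _ k

lemma load_arcPerm (f : Fin M × Fin d → Fin M × E) (k : Arc M d) :
    load f (arcPerm f k) = reverse (load f k) := (reverse_load f k).symm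

/-- The amplitude of an arc: the matrix element `H y x` in units of `2 Λ`, as far as the labels
tell. The two labels are averaged so that opposite arcs have conjugate amplitudes although the
labels need not be conjugate. Values outside the unit disc, which do not occur for the labels of
a matrix of norm at most `Λ`, are replaced by `0`. -/
def amplitude (val : E → ℂ) (Λ : ℝ) (z : LoadedArc M d E) : ℂ :=
  if IsMatched z then
    if ‖((starRingEnd ℂ) (val z.2.1.2) + val z.2.2.2) / (4 * Λ)‖ ≤ 1 then
      ((starRingEnd ℂ) (val z.2.1.2) + val z.2.2.2) / (4 * Λ) else 0
  else 0

lemma norm_amplitude_le (val : E → ℂ) (Λ : ℝ) (z : LoadedArc M d E) :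
    ‖amplitude val Λ z‖ ≤ 1 := by
  unfold amplitude; split_ifs <;> simp_all

lemma amplitude_reverse (val : E → ℂ) (Λ : ℝ) (z : LoadedArc M d E) :
    amplitude val Λ (reverse z) = (starRingEnd ℂ) (amplitude val Λ z) := by
  by_cases h : IsMatched z
  · have h' := (isMatched_reverse z).2 h
    have e : ((starRingEnd ℂ) (val (reverse z).2.1.2) + val (reverse z).2.2.2) / (4 * (Λ : ℂ))
        = (starRingEnd ℂ) (((starRingEnd ℂ) (val z.2.1.2) + val z.2.2.2) / (4 * Λ)) := by
      simp [reverse, h, add_comm, map_ofNat]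
    rw [amplitude, amplitude, if_pos h, if_pos h', e, Complex.norm_conj]
    split_ifs <;> simp
  · have h' := (isMatched_reverse z).not.2 h
    simp [amplitude, h, h']

/-- The reversal of the arcs combined with the dilation of their amplitudes. -/
def walk (val : E → ℂ) (Λ : ℝ) (f : Fin M × Fin d → Fin M × E) :
    Matrix (Arc M d × Bool) (Arc M d × Bool) ℂ :=
  ctrlMat (arcPerm f) fun k => dilate (amplitude val Λ (load f k))

lemma walk_unitary (val : E → ℂ) (Λ : ℝ) (f : Fin M × Fin d → Fin M × E) :
    walk val Λ f ∈ Matrix.unitaryGroup (Arc M d × Bool) ℂ :=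
  ctrlMat_unitary _ fun _ => dilate_unitary (norm_amplitude_le _ _ _)

lemma walk_isHermitian (val : E → ℂ) (Λ : ℝ) (f : Fin M × Fin d → Fin M × E) :
    (walk val Λ f)ᴴ = walk val Λ f := by
  have h : (arcPerm f)⁻¹ = arcPerm f := by
    ext1 k; rw [Equiv.Perm.inv_eq_iff_eq, arcPerm_arcPerm]
  rw [walk, ctrlMat_conjTranspose, h]
  congr 1
  funext k
  rw [dilate_conjTranspose, load_arcPerm, amplitude_reverse, Complex.conj_conj]

/-! ### Implementation of the walk -/

variable {G C : Type} [Fintype E] [DecidableEq E] [Fintype G] [DecidableEq G]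
  [Fintype C] [DecidableEq C]

lemma implementable_load {K B : Type} [Fintype K] [DecidableEq K] [Fintype B] [DecidableEq B]
    {g₀ : G} {b₀ : Fin M × E} (a₀ : Fin M × Fin d) (addr : K → Fin M × Fin d)
    (e : Fin M × E → Equiv.Perm K) (he : ∀ v k, addr (e v k) = addr k) :
    Implementable g₀ b₀ (fun x : K × B => (x, (((a₀, g₀), b₀) : QueryReg M d E G))) 2
      fun f => ctrlMat (addressedPerm addr (fun a => e (f a)) fun a => he (f a)) fun _ => 1 := by
  refine implementable_query a₀ (fun x => addr x.1) (fun v => (e v).prodCongr (Equiv.refl B))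
    (fun v x => he v x.1) _ fun f x x' => ?_
  simp only [ctrlMat_apply, addressedPerm, Equiv.coe_fn_mk, Matrix.one_apply, Prod.ext_iff,
    Equiv.prodCongr_apply, Prod.map, Equiv.refl_apply, ite_and]

/-- The embedding of the logical register, which consists of an arc, a qubit and a control
register `C`, next to blank registers for the two values of the arc. -/
def blankValues (b₀ : Fin M × E) (z : (Arc M d × Bool) × C) : (LoadedArc M d E × C) × Bool :=
  (((z.1.1, b₀, b₀), z.2), z.1.2)

lemma blankValues_injective (b₀ : Fin M × E) :
    Function.Injective (blankValues (M := M) (d := d) (C := C) b₀) := by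
  rintro ⟨⟨k, q⟩, m⟩ ⟨⟨k', q'⟩, m'⟩ h
  simp only [blankValues, Prod.mk.injEq] at h
  simp [h]

/-- Eight calls implement the walk, under the control of a register `C`. Only the middle gate is
controlled: without it, the computation and the uncomputation of the values cancel. -/
lemma implementable_walk {g₀ : G} {b₀ : Fin M × E} (a₀ : Fin M × Fin d) (val : E → ℂ) (Λ : ℝ)
    (on : C → Prop) [DecidablePred on] :
    Implementable g₀ b₀ ((fun x => (x, (((a₀, g₀), b₀) : QueryReg M d E G))) ∘
      blankValues (C := C) b₀) 8
      fun f => Matrix.blockDiagonal fun m => if on m then walk val Λ f else 1 := by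
  let e₁ : Fin M × E → Equiv.Perm (LoadedArc M d E × C) := fun v =>
    ((Equiv.refl _).prodCongr ((Equiv.swap b₀ v).prodCongr (Equiv.refl _))).prodCongr (Equiv.refl _)
  let e₂ : Fin M × E → Equiv.Perm (LoadedArc M d E × C) := fun v =>
    ((Equiv.refl _).prodCongr ((Equiv.refl _).prodCongr (Equiv.swap b₀ v))).prodCongr (Equiv.refl _)
  let addr₁ : LoadedArc M d E × C → Fin M × Fin d := fun k => (k.1.1.1, k.1.1.2.1)
  let addr₂ : LoadedArc M d E × C → Fin M × Fin d := fun k => (k.1.2.1.1, k.1.1.2.2)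
  have he₁ : ∀ v k, addr₁ (e₁ v k) = addr₁ k := fun v k => rfl
  have he₂ : ∀ v k, addr₂ (e₂ v k) = addr₂ k := fun v k => rfl
  let ℓ₁ := fun f : Fin M × Fin d → Fin M × E =>
    addressedPerm addr₁ (fun a => e₁ (f a)) fun a => he₁ (f a)
  let ℓ₂ := fun f : Fin M × Fin d → Fin M × E =>
    addressedPerm addr₂ (fun a => e₂ (f a)) fun a => he₂ (f a)
  have h₁ := implementable_load (B := Bool) (g₀ := g₀) (b₀ := b₀) a₀ addr₁ e₁ he₁
  have h₂ := implementable_load (B := Bool) (g₀ := g₀) (b₀ := b₀) a₀ addr₂ e₂ he₂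
  have hL := h₂.mul h₁
  have hLu : ∀ f, ctrlMat (ℓ₂ f) (fun _ => (1 : Matrix Bool Bool ℂ))
      * ctrlMat (ℓ₁ f) (fun _ => (1 : Matrix Bool Bool ℂ)) ∈ Matrix.unitaryGroup _ ℂ := fun f =>
    mul_mem (ctrlMat_unitary _ fun _ => one_mem _) (ctrlMat_unitary _ fun _ => one_mem _)
  let π : Equiv.Perm (LoadedArc M d E × C) :=
    Function.Involutive.toPerm (fun k => if on k.2 then (reverse k.1, k.2) else k) fun k => by
      by_cases h : on k.2 <;> simp [h, reverse_involutive k.1]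
  let g : LoadedArc M d E × C → Matrix Bool Bool ℂ := fun k =>
    if on k.2 then dilate (amplitude val Λ k.1) else 1
  have hg : ∀ k, g k ∈ Matrix.unitaryGroup Bool ℂ := fun k => by
    simp only [g]; split_ifs
    · exact dilate_unitary (norm_amplitude_le _ _ _)
    · exact one_mem _
  have hι : Function.Injective (fun x : (LoadedArc M d E × C) × Bool =>
      (x, (((a₀, g₀), b₀) : QueryReg M d E G))) := fun x y h => congrArg Prod.fst h
  refine (((hL.conjTranspose hLu).mul (Implementable.gate hι (ctrlMat_unitary π hg))).mul
    hL).restrict fun f => ?_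
  have hload : ∀ k m, ℓ₂ f (ℓ₁ f ((k, b₀, b₀), m)) = (load f k, m) := fun k m => by
    simp [ℓ₁, ℓ₂, addressedPerm, e₁, e₂, addr₁, addr₂, load]
  have hinv : ∀ k m, (ℓ₂ f * ℓ₁ f)⁻¹ (load f k, m) = ((k, b₀, b₀), m) := fun k m => by
    rw [Equiv.Perm.inv_eq_iff_eq, Equiv.Perm.mul_apply, hload]
  change (ctrlMat (ℓ₂ f) _ * ctrlMat (ℓ₁ f) _)ᴴ * ctrlMat π g * (ctrlMat (ℓ₂ f) _
    * ctrlMat (ℓ₁ f) _) * _ = _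
  simp only [ctrlMat_mul, ctrlMat_conjTranspose, Matrix.one_mul, Matrix.mul_one,
    Matrix.conjTranspose_one]
  rw [mul_inj]
  ext a ⟨⟨k, q⟩, m⟩
  simp only [Matrix.submatrix_apply, id_eq, ctrlMat_apply, blankValues, Equiv.Perm.mul_apply,
    hload]
  rw [Matrix.mul_apply]
  obtain ⟨σ, hσ⟩ : ∃ σ, σ = if on m then arcPerm f k else k := ⟨_, rfl⟩
  have hπ : π (load f k, m) = (load f σ, m) := by
    change (if on m then (reverse (load f k), m) else (load f k, m)) = _
    by_cases hm : on m <;> simp [hm, hσ, load_arcPerm]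
  have hentry : ∀ k' q', (if on m then walk val Λ f else 1) (k', q') (k, q)
      = if k' = σ then g (load f k, m) q' q else 0 := fun k' q' => by
    by_cases hm : on m
    · simp [hm, hσ, g, walk, ctrlMat_apply]
    · simp [hm, hσ, g, Matrix.one_apply, Prod.ext_iff, ite_and]
  simp only [hπ, hinv]
  obtain ⟨⟨⟨k', v⟩, m'⟩, q'⟩ := a
  rw [Finset.sum_eq_single ((k', q'), m)]
  · simp only [inj_apply, blankValues, Matrix.blockDiagonal_apply, if_true, hentry,
      Prod.mk.injEq, and_true, true_and]
    by_cases h1 : v = (b₀, b₀) <;> by_cases h2 : m' = m <;> by_cases h3 : k' = σ <;>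
      simp [h1, h2, h3]
  · rintro ⟨⟨k₁, q₁⟩, m₁⟩ _ hc
    by_cases h1 : m₁ = m
    · have h2 : (((k', v), m'), q') ≠ blankValues b₀ ((k₁, q₁), m₁) := by
        intro h
        simp only [blankValues, Prod.mk.injEq] at h
        exact hc (by simp [h, h1])
      rw [inj_apply, if_neg h2, zero_mul]
    · simp [Matrix.blockDiagonal_apply, h1]
  · simp

end Walk

/-! ### The block of the walk is the Hamiltonian -/

section Block

variable {M d : ℕ} {E : Type}

/-- The isometry `|x⟩ ↦ d⁻¹ ∑ i j, |x, i, j⟩`. -/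
def spread (M d : ℕ) : Matrix (Arc M d) (Fin M) ℂ :=
  Matrix.of fun k x => if k.1 = x then (d : ℂ)⁻¹ else 0

lemma spread_isometry (hd : d ≠ 0) : (spread M d)ᴴ * spread M d = 1 := by
  have hd' : (d : ℂ) ≠ 0 := by exact_mod_cast hd
  ext x' x
  simp only [Matrix.mul_apply, Matrix.conjTranspose_apply, spread, Matrix.of_apply,
    Fintype.sum_prod_type, Matrix.one_apply]
  rw [Finset.sum_eq_single x']
  · by_cases h : x' = x
    · simp [h]
      field_simp
    · simp [h]
  · intro b _ hb; simp [hb]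
  · simp

/-- An arc with the qubit in the state `|0⟩`. -/
def withZero (M d : ℕ) (k : Arc M d) : Arc M d × Bool := (k, false)

lemma withZero_injective : Function.Injective (withZero M d) :=
  fun _ _ h => congrArg Prod.fst h

/-- The isometry `|x⟩ ↦ d⁻¹ ∑ i j, |x, i, j⟩|0⟩` onto the initial states of the walk. -/
def start (M d : ℕ) : Matrix (Arc M d × Bool) (Fin M) ℂ :=
  inj (withZero M d) * spread M d

lemma start_isometry (hd : d ≠ 0) : (start M d)ᴴ * start M d = 1 := by
  rw [start, Matrix.conjTranspose_mul, Matrix.mul_assoc, ← Matrix.mul_assoc _ (inj _),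
    inj_isometry withZero_injective, Matrix.one_mul, spread_isometry hd]

/-- The matrix with entries `d⁻² ∑ c (x, i, j)`, where the sum is over the arcs `(x, i, j)` that
are mapped to arcs of `y`. -/
def arcSum (σ : Equiv.Perm (Arc M d)) (c : Arc M d → ℂ) : Matrix (Fin M) (Fin M) ℂ :=
  (spread M d)ᴴ * (inj σ * Matrix.diagonal c) * spread M d

lemma arcSum_apply (σ : Equiv.Perm (Arc M d)) (c : Arc M d → ℂ) (y x : Fin M) :
    arcSum σ c y x
      = ((d : ℂ) ^ 2)⁻¹ * ∑ i, ∑ j, if (σ (x, i, j)).1 = y then c (x, i, j) else 0 := by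
  rw [arcSum, ← Matrix.mul_assoc, mul_inj, Matrix.mul_assoc, Matrix.mul_apply]
  simp only [Matrix.submatrix_apply, id_eq, Matrix.conjTranspose_apply, Matrix.diagonal_mul,
    spread, Matrix.of_apply, Fintype.sum_prod_type]
  rw [Finset.sum_eq_single x]
  · rw [Finset.mul_sum]
    refine Finset.sum_congr rfl fun i _ => ?_
    rw [Finset.mul_sum]
    refine Finset.sum_congr rfl fun j _ => ?_
    by_cases h : (σ (x, i, j)).1 = y
    · simp [h]; ring
    · simp [h]
  · intro b _ hb; simp [hb]
  · simp

lemma norm_arcSum_le (hd : d ≠ 0) (σ : Equiv.Perm (Arc M d)) {c : Arc M d → ℂ} {δ : ℝ}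
    (hδ : 0 ≤ δ) (hc : ∀ k, ‖c k‖ ≤ δ) : ‖arcSum σ c‖ ≤ δ := by
  have h1 : ‖spread M d‖ ≤ 1 := norm_le_one_of_isometry (spread_isometry hd)
  have h2 : ‖(spread M d)ᴴ‖ ≤ 1 := (Matrix.l2_opNorm_conjTranspose _).trans_le h1
  have h3 : ‖(inj σ : Matrix (Arc M d) (Arc M d) ℂ)‖ ≤ 1 :=
    norm_le_one_of_isometry (inj_isometry σ.injective)
  have h4 : ‖(Matrix.diagonal c : Matrix (Arc M d) (Arc M d) ℂ)‖ ≤ δ := by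
    rw [Matrix.l2_opNorm_diagonal]
    exact (pi_norm_le_iff_of_nonneg hδ).2 hc
  have := norm_mul_le_of_norm_le_one
    (norm_mul_le_of_norm_le_one h2 (norm_mul_le_of_norm_le_one h3 h4)) h1
  simpa [arcSum] using this

lemma arcSum_smul_sub (σ : Equiv.Perm (Arc M d)) (a : ℂ) (c c' : Arc M d → ℂ) :
    a • arcSum σ c - arcSum σ c' = arcSum σ fun k => a * c k - c' k := by
  have h : (Matrix.diagonal fun k => a * c k - c' k : Matrix (Arc M d) (Arc M d) ℂ)
      = a • Matrix.diagonal c - Matrix.diagonal c' := by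
    rw [← Matrix.diagonal_smul, Matrix.diagonal_sub]; rfl
  simp only [arcSum, h, Matrix.mul_sub, Matrix.sub_mul, Matrix.mul_smul, Matrix.smul_mul]

lemma walk_block (val : E → ℂ) (Λ : ℝ) (f : Fin M × Fin d → Fin M × E) :
    (start M d)ᴴ * walk val Λ f * start M d
      = arcSum (arcPerm f) fun k => amplitude val Λ (load f k) := by
  have h : (inj (withZero M d))ᴴ * walk val Λ f * inj (withZero M d)
      = inj (arcPerm f) * Matrix.diagonal fun k => amplitude val Λ (load f k) := by
    rw [conjTranspose_inj_mul, mul_inj]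
    ext k' k
    simp only [Matrix.submatrix_apply, id_eq, walk, ctrlMat_apply, Matrix.mul_diagonal, inj_apply,
      withZero]
    split_ifs <;> simp [dilate]
  rw [arcSum, ← h, start, Matrix.conjTranspose_mul]
  simp only [Matrix.mul_assoc]

lemma norm_entry_le {H : Matrix (Fin M) (Fin M) ℂ} (x y : Fin M) : ‖H x y‖ ≤ ‖H‖ := by
  have h1 := Matrix.l2_opNorm_mulVec H (EuclideanSpace.single y (1 : ℂ))
  rw [PiLp.norm_single, norm_one, mul_one] at h1
  refine le_trans ?_ h1
  have h2 := PiLp.norm_apply_le ((EuclideanSpace.equiv (Fin M) ℂ).symm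
    (H *ᵥ (EuclideanSpace.single y (1 : ℂ)).ofLp)) x
  simpa using h2

/-- The block of the walk is the Hamiltonian in units of `2 d² Λ`, up to the precision `δ` of the
labels. -/
lemma norm_block_sub_le {val : E → ℂ} {zero : E} {Λ δ : ℝ} {H : Matrix (Fin M) (Fin M) ℂ}
    {f : Fin M × Fin d → Fin M × E} (hd : d ≠ 0) (hΛ : 0 < Λ) (hδ : 0 ≤ δ) (hδΛ : δ ≤ Λ)
    (hzero : val zero = 0) (hH : H.IsHermitian) (hn : ‖H‖ ≤ Λ)
    (hf : IsBlackBox val zero δ H f) :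
    ‖((2 * d ^ 2 * Λ : ℝ) : ℂ) • ((start M d)ᴴ * walk val Λ f * start M d) - H‖
      ≤ (d : ℝ) ^ 2 * δ := by
  choose D hD hbij hval hpad using hf
  have hdC : (d : ℂ) ≠ 0 := by exact_mod_cast hd
  have hsymm : ∀ x y, H x y ≠ 0 → H y x ≠ 0 := fun x y h h' => h (by
    rw [← hH.apply x y, h', star_zero])
  have hpad1 : ∀ x i, (f (x, i)).1 ≠ x → (i : ℕ) < D x := fun x i h => by
    by_contra h'
    exact h (by rw [hpad x i (not_lt.1 h')])
  have hinj : ∀ (x : Fin M) (i j : Fin d), (i : ℕ) < D x → (j : ℕ) < D x →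
      (f (x, i)).1 = (f (x, j)).1 → i = j := fun x i j hi hj h => (hbij x).injOn hi hj h
  -- the exact matrix elements of the matched arcs; an arc that starts at a padding index gets `0`
  let h : Arc M d → ℂ := fun k =>
    if IsMatched (load f k) ∧ (k.2.1 : ℕ) < D k.1 then H (f (k.1, k.2.1)).1 k.1 else 0
  have hexact : arcSum (arcPerm f) h = ((d : ℂ) ^ 2)⁻¹ • H := by
    ext y x
    rw [arcSum_apply, Matrix.smul_apply, smul_eq_mul]
    congr 1
    have hterm : ∀ i j, (if (arcPerm f (x, i, j)).1 = y then h (x, i, j) else 0)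
        = if IsMatched (load f (x, i, j)) ∧ (i : ℕ) < D x ∧ (f (x, i)).1 = y then H y x else 0 := by
      intro i j
      by_cases hm : IsMatched (load f (x, i, j))
      · have e : (arcPerm f (x, i, j)).1 = (f (x, i)).1 := by
          rw [arcPerm_apply, reverse, if_pos hm]; rfl
        by_cases hi : (i : ℕ) < D x <;> by_cases hy : (f (x, i)).1 = y <;> simp [h, hm, e, hi, hy]
      · simp [h, hm]
    simp only [hterm]
    by_cases hyx : H y x = 0
    · simp [hyx]
    obtain ⟨i₀, hi₀, hi₀'⟩ := (hbij x).surjOn (hsymm y x hyx)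
    obtain ⟨j₀, hj₀, hj₀'⟩ := (hbij y).surjOn (show x ∈ {x | H y x ≠ 0} from hyx)
    simp only [Set.mem_ofPred_eq] at hi₀ hi₀' hj₀ hj₀'
    rw [Finset.sum_eq_single i₀, Finset.sum_eq_single j₀, if_pos]
    · refine ⟨⟨by simp [load, hi₀', hj₀'], fun hxx => ?_⟩, hi₀, hi₀'⟩
      simp only [load] at hxx ⊢
      have hxy : y = x := by rw [← hi₀', hxx]
      subst hxy
      exact hinj y _ _ hi₀ hj₀ (by rw [hi₀', hj₀'])
    · intro j _ hj
      rw [if_neg]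
      rintro ⟨⟨h1, h2⟩, h3, h4⟩
      simp only [load, h4] at h1 h2
      by_cases hxy : y = x
      · subst hxy
        have e := h2 rfl
        subst e
        exact hj (hinj y _ _ h3 hj₀ (by rw [h1, hj₀']))
      · exact hj (hinj y _ _ (hpad1 y j (by rw [h1]; exact Ne.symm hxy)) hj₀ (by rw [h1, hj₀']))
    · simp
    · intro i _ hi
      refine Finset.sum_eq_zero fun j _ => if_neg ?_
      rintro ⟨_, h3, h4⟩
      exact hi (hinj x _ _ h3 hi₀ (by rw [h4, hi₀']))
    · simp
  have hclose : ∀ k, ‖((2 * Λ : ℝ) : ℂ) * amplitude val Λ (load f k) - h k‖ ≤ δ := by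
    rintro ⟨x, i, j⟩
    by_cases hm : IsMatched (load f (x, i, j))
    swap
    · simp [h, hm, amplitude, hδ]
    obtain ⟨h1, h2⟩ := hm
    simp only [load] at h1 h2
    by_cases hi : (i : ℕ) < D x
    · set y := (f (x, i)).1 with hy
      have hj : (j : ℕ) < D y := by
        by_cases hxy : y = x
        · rw [hxy, ← h2 hxy]; exact hi
        · exact hpad1 y j (by rw [h1]; exact Ne.symm hxy)
      have a1 : ‖val (f (x, i)).2 - H x y‖ ≤ δ := hval x i hi
      have a2 : ‖val (f (y, j)).2 - H y x‖ ≤ δ := by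
        have := hval y j hj
        rwa [h1] at this
      have a3 : ‖(starRingEnd ℂ) (val (f (x, i)).2) - H y x‖ ≤ δ := by
        rw [← hH.apply y x, Complex.star_def, ← map_sub, Complex.norm_conj]
        exact a1
      have a4 : ‖H y x‖ ≤ Λ := (norm_entry_le y x).trans hn
      have hΛC : (Λ : ℂ) ≠ 0 := by exact_mod_cast hΛ.ne'
      have a5 : ‖((starRingEnd ℂ) (val (f (x, i)).2) + val (f (y, j)).2) / (4 * Λ)‖ ≤ 1 := by
        have : ‖(starRingEnd ℂ) (val (f (x, i)).2) + val (f (y, j)).2‖ ≤ 4 * Λ := by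
          have e : (starRingEnd ℂ) (val (f (x, i)).2) + val (f (y, j)).2
              = ((starRingEnd ℂ) (val (f (x, i)).2) - H y x) + (val (f (y, j)).2 - H y x)
                + (2 : ℂ) * H y x := by ring
          rw [e]
          refine norm_add₃_le.trans ?_
          rw [norm_mul]
          norm_num
          linarith
        rw [norm_div, norm_mul, Complex.norm_real, Real.norm_of_nonneg hΛ.le]
        rw [div_le_one (by norm_num; exact hΛ)]
        simpa using this
      have e1 : amplitude val Λ (load f (x, i, j))
          = ((starRingEnd ℂ) (val (f (x, i)).2) + val (f (y, j)).2) / (4 * Λ) := by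
        rw [amplitude, if_pos ⟨h1, h2⟩]
        exact if_pos a5
      have e2 : h (x, i, j) = H y x := if_pos ⟨⟨h1, h2⟩, hi⟩
      rw [e1, e2]
      have e3 : ((2 * Λ : ℝ) : ℂ)
            * (((starRingEnd ℂ) (val (f (x, i)).2) + val (f (y, j)).2) / (4 * Λ)) - H y x
          = (1 / 2 : ℂ) * (((starRingEnd ℂ) (val (f (x, i)).2) - H y x)
            + (val (f (y, j)).2 - H y x)) := by
        push_cast; field_simp; ring
      rw [e3, norm_mul]
      have := norm_add_le ((starRingEnd ℂ) (val (f (x, i)).2) - H y x) (val (f (y, j)).2 - H y x)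
      norm_num
      linarith
    · -- both labels of a padding arc represent `0`
      have hfx := hpad x i (not_lt.1 hi)
      have hij : i = j := h2 (by rw [hfx])
      subst hij
      have e1 : amplitude val Λ (load f (x, i, i)) = 0 := by
        rw [amplitude]
        simp [load, hfx, hzero]
      have e2 : h (x, i, i) = 0 := if_neg fun h' => hi h'.2
      rw [e1, e2]
      simpa using hδ
  have e : ((2 * d ^ 2 * Λ : ℝ) : ℂ) • ((start M d)ᴴ * walk val Λ f * start M d) - H
      = ((d : ℂ) ^ 2) • arcSum (arcPerm f)
        (fun k => ((2 * Λ : ℝ) : ℂ) * amplitude val Λ (load f k) - h k) := by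
    rw [← arcSum_smul_sub, hexact, walk_block, smul_sub, smul_smul, smul_smul,
      mul_inv_cancel₀ (pow_ne_zero 2 hdC), one_smul]
    congr 2
    push_cast; ring
  rw [e, norm_smul]
  have := norm_arcSum_le hd (arcPerm f) hδ hclose
  simpa using mul_le_mul_of_nonneg_left this (by positivity : (0 : ℝ) ≤ (d : ℝ) ^ 2)

end Block

/-! ### The generator of the walk and its Taylor polynomials -/

section Generator

variable {Y S : Type} [Fintype Y] [DecidableEq Y] [Fintype S] [DecidableEq S]

/-- The walk operator of a Hermitian unitary `W` and an isometry `J`: `W` is followed by the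
reflection about the range of `J`. -/
def walkOp (W : Matrix Y Y ℂ) (J : Matrix Y S ℂ) : Matrix Y Y ℂ :=
  ((2 : ℂ) • (J * Jᴴ) - 1) * W

/-- The Hermitian part of the walk operator. -/
def generator (W : Matrix Y Y ℂ) (J : Matrix Y S ℂ) : Matrix Y Y ℂ :=
  (1 / 2 : ℂ) • (walkOp W J + (walkOp W J)ᴴ)

variable {W : Matrix Y Y ℂ} {J : Matrix Y S ℂ}

lemma walkOp_unitary (hW : W ∈ Matrix.unitaryGroup Y ℂ) (hJ : Jᴴ * J = 1) :
    walkOp W J ∈ Matrix.unitaryGroup Y ℂ := mul_mem (reflection_unitary hJ) hW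

lemma generator_isHermitian : (generator W J).IsHermitian := by
  rw [Matrix.IsHermitian, generator, Matrix.conjTranspose_smul, Matrix.conjTranspose_add,
    Matrix.conjTranspose_conjTranspose, add_comm]
  simp

/-- The generator leaves the range of `J` invariant and acts on it as the block of `W`. -/
lemma generator_mul (hW : Wᴴ = W) (hJ : Jᴴ * J = 1) :
    generator W J * J = J * (Jᴴ * W * J) := by
  have h1 : walkOp W J * J = (2 : ℂ) • (J * (Jᴴ * W * J)) - W * J := by
    rw [walkOp, Matrix.sub_mul, Matrix.sub_mul, Matrix.one_mul]
    simp [Matrix.mul_assoc]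
  have h2 : (walkOp W J)ᴴ * J = W * J := by
    have : (walkOp W J)ᴴ = W * ((2 : ℂ) • (J * Jᴴ) - 1) := by
      rw [walkOp, Matrix.conjTranspose_mul, hW]
      simp [Matrix.conjTranspose_smul]
    rw [this, Matrix.mul_assoc, Matrix.sub_mul, Matrix.one_mul, Matrix.smul_mul, Matrix.mul_assoc,
      hJ, Matrix.mul_one]
    congr 1
    module
  rw [generator, Matrix.smul_mul, Matrix.add_mul, h1, h2]
  module

lemma norm_generator_le (hW : W ∈ Matrix.unitaryGroup Y ℂ) (hJ : Jᴴ * J = 1) :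
    ‖generator W J‖ ≤ 1 := by
  have h1 := norm_unitary_le_one (walkOp_unitary hW hJ)
  have h2 := norm_unitary_le_one (unitary_conjTranspose (walkOp_unitary hW hJ))
  rw [generator, norm_smul]
  have := norm_add_le (walkOp W J) (walkOp W J)ᴴ
  norm_num
  linarith

end Generator

section Weight

open Polynomial

/-- The sum of the absolute values of the coefficients of `p` is at most `w`. -/
def HasWeight (p : ℂ[X]) (w : ℝ) : Prop := ∀ N, ∑ m ∈ Finset.range N, ‖p.coeff m‖ ≤ w

lemma HasWeight.add {p q : ℂ[X]} {v w : ℝ} (hp : HasWeight p v) (hq : HasWeight q w) :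
    HasWeight (p + q) (v + w) := fun N => by
  refine (Finset.sum_le_sum fun m _ => ?_).trans
    ((Finset.sum_add_distrib (s := Finset.range N)).trans_le (add_le_add (hp N) (hq N)))
  rw [coeff_add]
  exact norm_add_le _ _

lemma HasWeight.sum {p : ℕ → ℂ[X]} {w : ℕ → ℝ} (h : ∀ j, HasWeight (p j) (w j)) (n : ℕ) :
    HasWeight (∑ j ∈ Finset.range n, p j) (∑ j ∈ Finset.range n, w j) := by
  induction n with
  | zero => intro N; simp
  | succ n ih => rw [Finset.sum_range_succ, Finset.sum_range_succ]; exact ih.add (h n)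

lemma HasWeight.smul {p : ℂ[X]} {w : ℝ} (hp : HasWeight p w) (a : ℂ) :
    HasWeight (a • p) (‖a‖ * w) := fun N => by
  simp only [coeff_smul, smul_eq_mul, norm_mul, ← Finset.mul_sum]
  exact mul_le_mul_of_nonneg_left (hp N) (norm_nonneg _)

lemma HasWeight.X_mul {p : ℂ[X]} {w : ℝ} (hp : HasWeight p w) : HasWeight (X * p) w := fun N => by
  cases N with
  | zero => exact hp 0
  | succ N => simpa [Finset.sum_range_succ', coeff_X_mul] using hp N

lemma hasWeight_walk (a j : ℕ) : HasWeight (X ^ a * (X ^ 2 + 1) ^ j : ℂ[X]) (2 ^ j) := by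
  have h1 : HasWeight ((X ^ 2 + 1) ^ j : ℂ[X]) (2 ^ j) := by
    induction j with
    | zero =>
      intro N
      cases N with
      | zero => simp
      | succ N => simp [Finset.sum_range_succ', coeff_one]
    | succ j ih =>
      have e : ((X ^ 2 + 1) ^ (j + 1) : ℂ[X]) = X * (X * (X ^ 2 + 1) ^ j) + (X ^ 2 + 1) ^ j := by
        ring
      rw [e, pow_succ (2 : ℝ), mul_two]
      exact ih.X_mul.X_mul.add ih
  induction a with
  | zero => simpa using h1
  | succ a ih =>
    rw [pow_succ', mul_assoc]
    exact ih.X_mul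

/-- The Taylor polynomial of `exp (-i β (X + X⁻¹) / 2)` of degree `K`, multiplied by `X ^ K`. -/
def taylorPoly (β : ℝ) (K : ℕ) : ℂ[X] :=
  ∑ j ∈ Finset.range (K + 1), (((j.factorial : ℂ)⁻¹) * (-(Complex.I * β) / 2) ^ j) •
    (X ^ (K - j) * (X ^ 2 + 1) ^ j)

lemma natDegree_taylorPoly_le (β : ℝ) (K : ℕ) : (taylorPoly β K).natDegree ≤ 2 * K := by
  refine natDegree_sum_le_of_forall_le _ _ fun j hj => ?_
  rw [Finset.mem_range] at hj
  refine (natDegree_smul_le _ _).trans (natDegree_mul_le.trans ?_)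
  have h1 : (X ^ (K - j) : ℂ[X]).natDegree ≤ K - j := natDegree_X_pow_le _
  have h2 : ((X ^ 2 + 1) ^ j : ℂ[X]).natDegree ≤ j * 2 := by
    refine natDegree_pow_le.trans (Nat.mul_le_mul_left j ?_)
    exact natDegree_add_le_of_degree_le (natDegree_X_pow_le 2) (by simp)
  omega

lemma hasWeight_taylorPoly {β : ℝ} (hβ : 0 ≤ β) (hβ' : β ≤ 1 / 2) (K : ℕ) :
    HasWeight (taylorPoly β K) 2 := by
  intro N
  refine (HasWeight.sum (fun j => (hasWeight_walk (K - j) j).smul _) (K + 1) N).trans ?_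
  have h : ∀ j : ℕ, ‖((j.factorial : ℂ)⁻¹) * (-(Complex.I * β) / 2) ^ j‖ * (2 : ℝ) ^ j
      ≤ (1 / 2) ^ j := fun j => by
    have h2 : ((j.factorial : ℝ))⁻¹ ≤ 1 :=
      inv_le_one_of_one_le₀ (by exact_mod_cast j.factorial_pos)
    have e : ‖-(Complex.I * (β : ℂ)) / 2‖ = β / 2 := by
      simp [abs_of_nonneg hβ]
    rw [norm_mul, norm_pow, e, norm_inv, Complex.norm_natCast, mul_assoc, ← mul_pow,
      div_mul_cancel₀ _ (two_ne_zero)]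
    exact (mul_le_of_le_one_left (by positivity) h2).trans (pow_le_pow_left₀ hβ hβ' j)
  refine (Finset.sum_le_sum fun j _ => h j).trans ?_
  have := geom_sum_eq (show (1 / 2 : ℝ) ≠ 1 by norm_num) (K + 1)
  rw [this]
  have : (0 : ℝ) ≤ (1 / 2) ^ (K + 1) := by positivity
  rw [div_le_iff_of_neg (by norm_num)]
  linarith

variable {Y S : Type} [Fintype Y] [DecidableEq Y] [Fintype S] [DecidableEq S]
  {W : Matrix Y Y ℂ} {J : Matrix Y S ℂ}

/-- The walk operator evaluates `taylorPoly` to a truncated exponential of the generator. -/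
lemma conjTranspose_pow_mul_taylorPoly (hW : W ∈ Matrix.unitaryGroup Y ℂ) (hJ : Jᴴ * J = 1)
    (β : ℝ) (K : ℕ) :
    (walkOp W J)ᴴ ^ K
        * ∑ m ∈ Finset.range (2 * K + 1), (taylorPoly β K).coeff m • walkOp W J ^ m
      = ∑ j ∈ Finset.range (K + 1),
        ((j.factorial : ℂ)⁻¹) • ((-(Complex.I * (β : ℂ))) • generator W J) ^ j := by
  set V := walkOp W J with hV
  have h1 : Vᴴ * V = 1 := Matrix.mem_unitaryGroup_iff'.1 (walkOp_unitary hW hJ)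
  have h2 : V * Vᴴ = 1 := Matrix.mem_unitaryGroup_iff.1 (walkOp_unitary hW hJ)
  have hc : Commute V Vᴴ := by rw [Commute, SemiconjBy, h1, h2]
  have hcg : Commute V (generator W J) :=
    ((Commute.refl V).add_right hc).smul_right _
  have hVg : V * generator W J = (1 / 2 : ℂ) • (V ^ 2 + 1) := by
    rw [generator, Matrix.mul_smul, Matrix.mul_add, ← hV, h2, sq]
  have hsum : ∑ m ∈ Finset.range (2 * K + 1), (taylorPoly β K).coeff m • V ^ m
      = aeval V (taylorPoly β K) :=
    (aeval_eq_sum_range' (Nat.lt_succ_of_le (natDegree_taylorPoly_le β K)) V).symm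
  rw [hsum, taylorPoly, map_sum, Finset.mul_sum]
  refine Finset.sum_congr rfl fun j hj => ?_
  have hjK : j ≤ K := Nat.lt_succ_iff.1 (Finset.mem_range.1 hj)
  have hinv : Vᴴ ^ K * V ^ K = 1 := by rw [← hc.symm.mul_pow, h1, one_pow]
  have e1 : V ^ (K - j) * (V ^ 2 + 1) ^ j = (2 : ℂ) ^ j • (V ^ K * generator W J ^ j) := by
    have : V ^ 2 + 1 = (2 : ℂ) • (V * generator W J) := by rw [hVg, smul_smul]; norm_num
    rw [this, _root_.smul_pow, Matrix.mul_smul, hcg.mul_pow, ← Matrix.mul_assoc, ← pow_add,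
      Nat.sub_add_cancel hjK]
  simp only [map_smul, map_mul, map_pow, aeval_X, map_add, map_one]
  rw [e1, smul_smul, Matrix.mul_smul, ← Matrix.mul_assoc, hinv, Matrix.one_mul, _root_.smul_pow,
    smul_smul, div_pow, mul_assoc, div_mul_cancel₀ _ (pow_ne_zero j two_ne_zero)]

end Weight

/-! ### Linear combinations of unitaries -/

section LCU

variable {Y C : Type} [Fintype Y] [DecidableEq Y] [Fintype C] [DecidableEq C]

/-- The map `|y⟩ ↦ |y⟩|a⟩`. -/
def attach (Y : Type) [DecidableEq Y] (a : C → ℂ) : Matrix (Y × C) Y ℂ :=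
  Matrix.of fun z y => if z.1 = y then a z.2 else 0

lemma attach_block (a b : C → ℂ) (F : C → Matrix Y Y ℂ) :
    (attach Y b)ᴴ * Matrix.blockDiagonal F * attach Y a
      = ∑ m, ((starRingEnd ℂ) (b m) * a m) • F m := by
  ext y y'
  have h1 : ∀ z : Y × C, ((attach Y b)ᴴ * Matrix.blockDiagonal F) y z
      = (starRingEnd ℂ) (b z.2) * F z.2 y z.1 := by
    rintro ⟨y₁, m⟩
    rw [Matrix.mul_apply, Finset.sum_eq_single (y, m)]
    · simp [attach, Matrix.blockDiagonal_apply]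
    · rintro ⟨y₂, m₂⟩ _ h
      by_cases hy : y₂ = y
      · have hm : m₂ ≠ m := fun hm => h (by rw [hy, hm])
        simp [Matrix.blockDiagonal_apply, hm]
      · simp [attach, hy]
    · simp
  rw [Matrix.mul_apply, Matrix.sum_apply]
  simp only [h1, Fintype.sum_prod_type, Matrix.smul_apply, smul_eq_mul]
  simp only [attach, Matrix.of_apply]
  rw [Finset.sum_eq_single y']
  · exact Finset.sum_congr rfl fun m _ => by rw [if_pos rfl]; ring
  · intro b _ hb; simp [hb]
  · simp

lemma attach_isometry {a : C → ℂ} (ha : ∑ m, ‖a m‖ ^ 2 = 1) : (attach Y a)ᴴ * attach Y a = 1 := by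
  have h := attach_block (Y := Y) a a fun _ => 1
  have h1 : (Matrix.blockDiagonal fun _ : C => (1 : Matrix Y Y ℂ)) = 1 := Matrix.blockDiagonal_one
  rw [h1, Matrix.mul_one] at h
  rw [h, ← Finset.sum_smul]
  have : ∑ m, (starRingEnd ℂ) (a m) * a m = 1 := by
    simp only [Complex.conj_mul']
    exact_mod_cast ha
  rw [this, one_smul]

/-- Amplitudes for a linear combination with coefficients `c` of total weight at most `2`: the
weighted overlaps of two unit vectors are the halved coefficients. Two additional basis states
take up the rest of the norm of one vector each. -/
lemma exists_amplitudes {N : ℕ} (c : Fin N → ℂ) (hc : ∑ m, ‖c m‖ ≤ 2) :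
    ∃ a b : Fin N ⊕ Bool → ℂ, ∑ m, ‖a m‖ ^ 2 = 1 ∧ ∑ m, ‖b m‖ ^ 2 = 1 ∧
      (∀ m, (starRingEnd ℂ) (b (.inl m)) * a (.inl m) = c m / 2) ∧
      ∀ s, (starRingEnd ℂ) (b (.inr s)) * a (.inr s) = 0 := by
  set ρ : ℝ := Real.sqrt (1 - (∑ m, ‖c m‖) / 2) with hρ
  have hρ2 : ρ ^ 2 = 1 - (∑ m, ‖c m‖) / 2 := Real.sq_sqrt (by linarith)
  have hs : ∀ m, Real.sqrt (‖c m‖ / 2) ^ 2 = ‖c m‖ / 2 := fun m => Real.sq_sqrt (by positivity)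
  refine ⟨Sum.elim (fun m => (Real.sqrt (‖c m‖ / 2) : ℂ)) fun s => if s then 0 else (ρ : ℂ),
    Sum.elim (fun m => (starRingEnd ℂ) (c m) / 2 / (Real.sqrt (‖c m‖ / 2) : ℂ))
      fun s => if s then (ρ : ℂ) else 0, ?_, ?_, ?_, ?_⟩
  · have h : ∀ m, ‖(Real.sqrt (‖c m‖ / 2) : ℂ)‖ ^ 2 = ‖c m‖ / 2 := fun m => by
      rw [Complex.norm_real, Real.norm_of_nonneg (Real.sqrt_nonneg _), hs]
    simp only [Fintype.sum_sum_type, Sum.elim_inl, h]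
    simp [hρ2, ← Finset.sum_div]
  · have h : ∀ m, ‖(starRingEnd ℂ) (c m) / 2 / (Real.sqrt (‖c m‖ / 2) : ℂ)‖ ^ 2 = ‖c m‖ / 2 := by
      intro m
      rw [norm_div, div_pow, Complex.norm_real, Real.norm_of_nonneg (Real.sqrt_nonneg _), hs,
        norm_div, Complex.norm_conj]
      by_cases h0 : ‖c m‖ = 0
      · simp [h0]
      · simp only [Complex.norm_ofNat]; field_simp
    simp only [Fintype.sum_sum_type, Sum.elim_inl, h]
    simp [hρ2, ← Finset.sum_div]
  · intro m
    simp only [Sum.elim_inl, map_div₀, Complex.conj_conj, Complex.conj_ofReal, map_ofNat]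
    by_cases h0 : c m = 0
    · simp [h0]
    · have : (Real.sqrt (‖c m‖ / 2) : ℂ) ≠ 0 := by
        rw [Complex.ofReal_ne_zero, Real.sqrt_ne_zero (by positivity)]
        have := norm_pos_iff.2 h0
        positivity
      field_simp
  · intro s; cases s <;> simp

end LCU

/-! ### Simulation of the evolution -/

lemma norm_pow_mul_sub_mul_pow_le {Ω Y : Type} [Fintype Ω] [DecidableEq Ω] [Fintype Y]
    [DecidableEq Y] {Q : Matrix Ω Ω ℂ} {J : Matrix Ω Y ℂ} {F : Matrix Y Y ℂ} {ξ : ℝ}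
    (hQ : Q ∈ Matrix.unitaryGroup Ω ℂ) (hF : F ∈ Matrix.unitaryGroup Y ℂ)
    (h : ‖Q * J - J * F‖ ≤ ξ) (r : ℕ) : ‖Q ^ r * J - J * F ^ r‖ ≤ r * ξ := by
  induction r with
  | zero => simp
  | succ r ih =>
    have e : Q ^ (r + 1) * J - J * F ^ (r + 1)
        = Q ^ r * (Q * J - J * F) + (Q ^ r * J - J * F ^ r) * F := by
      rw [pow_succ, pow_succ, Matrix.mul_sub, Matrix.sub_mul]
      simp only [Matrix.mul_assoc]
      abel
    have h1 := norm_mul_le_of_norm_le_one (norm_unitary_le_one (pow_mem hQ r)) h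
    have h2 := norm_mul_le_of_norm_le_one ih (norm_unitary_le_one hF)
    rw [e]
    refine (norm_add_le _ _).trans ?_
    push_cast
    linarith

section BlockDiagonal

variable {Y C : Type} [Fintype Y] [DecidableEq Y] [Fintype C] [DecidableEq C]

lemma blockDiagonal_unitary {F : C → Matrix Y Y ℂ} (hF : ∀ m, F m ∈ Matrix.unitaryGroup Y ℂ) :
    Matrix.blockDiagonal F ∈ Matrix.unitaryGroup (Y × C) ℂ := by
  rw [Matrix.mem_unitaryGroup_iff, Matrix.star_eq_conjTranspose,
    Matrix.blockDiagonal_conjTranspose, ← Matrix.blockDiagonal_mul, ← Matrix.blockDiagonal_one]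
  congr 1
  funext m
  exact Matrix.mem_unitaryGroup_iff.1 (hF m)

variable {M d : ℕ} {E G X : Type} [Fintype E] [DecidableEq E] [Fintype G] [DecidableEq G]
  [Fintype X] [DecidableEq X] {g₀ : G} {b₀ : Fin M × E} {ι : Y × C → X × QueryReg M d E G}

/-- Powers of an operator with the exponent in a control register, by a sequence of steps that are
controlled by a comparison of the exponent with a number. -/
lemma implementable_controlled_pow (hι : Function.Injective ι) {n : ℕ}
    {V : (Fin M × Fin d → Fin M × E) → Matrix Y Y ℂ}
    (h : ∀ (on : C → Prop) [DecidablePred on], Implementable g₀ b₀ ι n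
      fun f => Matrix.blockDiagonal fun m => if on m then V f else 1) (k : C → ℕ) (L : ℕ) :
    Implementable g₀ b₀ ι (L * n) fun f => Matrix.blockDiagonal fun m => V f ^ min (k m) L := by
  induction L with
  | zero =>
    have e : (Matrix.blockDiagonal fun _ : C => (1 : Matrix Y Y ℂ)) = 1 :=
      Matrix.blockDiagonal_one
    simpa [e] using Implementable.gate hι (one_mem _)
  | succ L ih =>
    have h1 := ih.mul (h fun m => L < k m)
    rw [add_mul, one_mul]
    convert h1 using 2 with f
    rw [← Matrix.blockDiagonal_mul]
    congr 1
    funext m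
    by_cases hm : L < k m
    · rw [if_pos hm, ← pow_succ, min_eq_right hm, min_eq_right hm.le]
    · rw [if_neg hm, mul_one, min_eq_left (not_lt.1 hm),
        min_eq_left ((not_lt.1 hm).trans (Nat.le_succ L))]

end BlockDiagonal

section Simulation

variable {M d : ℕ} {E G : Type} [Fintype E] [DecidableEq E] [Fintype G] [DecidableEq G]

/-- The control register for linear combinations of the first `2 K + 1` powers: an exponent or one
of two additional states. -/
abbrev Counter (K : ℕ) : Type := Fin (2 * K + 1) ⊕ Bool

/-- The embedding of the logical register, next to blank registers for the values of an arc and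
for the black box. -/
def logical (K : ℕ) (a₀ : Fin M × Fin d) (g₀ : G) (b₀ : Fin M × E) :
    (Arc M d × Bool) × Counter K → ((LoadedArc M d E × Counter K) × Bool) × QueryReg M d E G :=
  (fun x => (x, (((a₀, g₀), b₀) : QueryReg M d E G))) ∘ blankValues b₀

lemma logical_injective (K : ℕ) (a₀ : Fin M × Fin d) (g₀ : G) (b₀ : Fin M × E) :
    Function.Injective (logical K a₀ g₀ b₀) :=
  Function.Injective.comp (fun _ _ h => congrArg Prod.fst h) (blankValues_injective b₀)

/-- A walk state with a blank counter. -/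
def zeroCounter (M d K : ℕ) (y : Arc M d × Bool) : (Arc M d × Bool) × Counter K := (y, .inl 0)

lemma zeroCounter_injective (M d K : ℕ) : Function.Injective (zeroCounter M d K) :=
  fun _ _ h => congrArg Prod.fst h

lemma implementable_controlled_walkOp (K : ℕ) (a₀ : Fin M × Fin d) (g₀ : G) (b₀ : Fin M × E)
    (hd : d ≠ 0) (val : E → ℂ) (Λ : ℝ) (on : Counter K → Prop) [DecidablePred on] :
    Implementable g₀ b₀ (logical K a₀ g₀ b₀) 8 fun f =>
      Matrix.blockDiagonal fun m => if on m then walkOp (walk val Λ f) (start M d) else 1 := by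
  have hR : Matrix.blockDiagonal (fun m : Counter K => if on m then
      (2 : ℂ) • (start M d * (start M d)ᴴ) - 1 else 1) ∈ Matrix.unitaryGroup _ ℂ :=
    blockDiagonal_unitary fun m => by
      split_ifs
      · exact reflection_unitary (start_isometry hd)
      · exact one_mem _
  have h := (Implementable.gate (logical_injective K a₀ g₀ b₀) hR).mul
    (implementable_walk (g₀ := g₀) (b₀ := b₀) a₀ val Λ on)
  rw [zero_add] at h
  convert h using 2 with f
  rw [← Matrix.blockDiagonal_mul]
  congr 1
  funext m
  split_ifs
  · rfl
  · simp

/-- One segment of the simulation: the linear combination of powers of the walk operator for a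
truncated exponential, followed by amplitude amplification. -/
lemma exists_segment (K : ℕ) (a₀ : Fin M × Fin d) (g₀ : G) (b₀ : Fin M × E)
    (hd : d ≠ 0) (val : E → ℂ) (Λ : ℝ) {β : ℝ} (hβ : 0 ≤ β) (hβ' : β ≤ 1 / 2) :
    ∃ Q : (Fin M × Fin d → Fin M × E) →
        Matrix ((Arc M d × Bool) × Counter K) ((Arc M d × Bool) × Counter K) ℂ,
      Implementable g₀ b₀ (logical K a₀ g₀ b₀) (72 * K) Q ∧
      ∀ f, Q f ∈ Matrix.unitaryGroup _ ℂ ∧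
        ‖Q f * inj (zeroCounter M d K) - inj (zeroCounter M d K)
          * NormedSpace.exp ((-(Complex.I * (β : ℂ))) • generator (walk val Λ f) (start M d))‖ ^ 2
          ≤ 10 * (1 / 2) ^ K := by
  have hι := logical_injective K a₀ g₀ b₀
  set V : (Fin M × Fin d → Fin M × E) → Matrix (Arc M d × Bool) (Arc M d × Bool) ℂ :=
    fun f => walkOp (walk val Λ f) (start M d) with hV
  have hVu : ∀ f, V f ∈ Matrix.unitaryGroup _ ℂ := fun f =>
    walkOp_unitary (walk_unitary val Λ f) (start_isometry hd)
  set J : Matrix ((Arc M d × Bool) × Counter K) (Arc M d × Bool) ℂ := inj (zeroCounter M d K)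
    with hJdef
  have hJ : Jᴴ * J = 1 := inj_isometry (zeroCounter_injective M d K)
  obtain ⟨a, b, ha, hb, hab, hab'⟩ := exists_amplitudes
    (fun m : Fin (2 * K + 1) => (taylorPoly β K).coeff m) (by
      have := hasWeight_taylorPoly hβ hβ' K (2 * K + 1)
      rwa [Finset.sum_range] at this)
  obtain ⟨Ga, hGa, hGa'⟩ := exists_unitary_mul_inj (zeroCounter_injective M d K)
    (attach_isometry (Y := Arc M d × Bool) ha)
  obtain ⟨Gb, hGb, hGb'⟩ := exists_unitary_mul_inj (zeroCounter_injective M d K)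
    (attach_isometry (Y := Arc M d × Bool) hb)
  have hctrl := fun (on : Counter K → Prop) [DecidablePred on] =>
    implementable_controlled_walkOp K a₀ g₀ b₀ hd val Λ on
  let exponent : Counter K → ℕ := Sum.elim (fun m => m) fun _ => 0
  have hpow := implementable_controlled_pow hι hctrl exponent (2 * K)
  have hback : Implementable g₀ b₀ (logical K a₀ g₀ b₀) (K * 8) fun f =>
      Matrix.blockDiagonal fun _ : Counter K => (V f)ᴴ ^ K := by
    have h1 := (hctrl fun _ => True).conjTranspose fun f => blockDiagonal_unitary fun m => by
      simpa using hVu f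
    have h2 := h1.pow hι K
    convert h2 using 2 with f
    rw [Matrix.blockDiagonal_conjTranspose, ← Matrix.blockDiagonal_pow]
    simp only [if_true]
    rfl
  set T : (Fin M × Fin d → Fin M × E) →
      Matrix ((Arc M d × Bool) × Counter K) ((Arc M d × Bool) × Counter K) ℂ := fun f =>
    Gbᴴ * (Matrix.blockDiagonal (fun _ : Counter K => (V f)ᴴ ^ K)
      * Matrix.blockDiagonal (fun m => V f ^ min (exponent m) (2 * K))) * Ga with hT
  have hTi : Implementable g₀ b₀ (logical K a₀ g₀ b₀) (24 * K) T := by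
    have h1 := ((Implementable.gate hι (unitary_conjTranspose hGb)).mul (hback.mul hpow)).mul
      (Implementable.gate hι hGa)
    convert h1 using 1
    ring
  have hTu : ∀ f, T f ∈ Matrix.unitaryGroup _ ℂ := fun f =>
    mul_mem (mul_mem (unitary_conjTranspose hGb) (mul_mem
      (blockDiagonal_unitary fun _ => pow_mem (unitary_conjTranspose (hVu f)) K)
      (blockDiagonal_unitary fun _ => pow_mem (hVu f) _))) hGa
  have hTblock : ∀ f, Jᴴ * T f * J = (1 / 2 : ℂ) • ∑ j ∈ Finset.range (K + 1),
      ((j.factorial : ℂ)⁻¹) •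
        ((-(Complex.I * (β : ℂ))) • generator (walk val Λ f) (start M d)) ^ j := by
    intro f
    have e1 : Jᴴ * T f * J = (attach (Arc M d × Bool) b)ᴴ
        * (Matrix.blockDiagonal (fun _ : Counter K => (V f)ᴴ ^ K)
          * Matrix.blockDiagonal (fun m => V f ^ min (exponent m) (2 * K)))
        * attach (Arc M d × Bool) a := by
      rw [← hGa', ← hGb', Matrix.conjTranspose_mul]
      simp only [hT, hJdef, Matrix.mul_assoc]
    rw [e1, ← Matrix.blockDiagonal_mul, attach_block,
      ← conjTranspose_pow_mul_taylorPoly (walk_unitary val Λ f) (start_isometry hd),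
      Fintype.sum_sum_type]
    simp only [hab, hab', zero_smul, Finset.sum_const_zero, add_zero]
    rw [Finset.sum_range, Finset.mul_sum, Finset.smul_sum]
    refine Finset.sum_congr rfl fun m _ => ?_
    have hm : min (exponent (.inl m)) (2 * K) = m := min_eq_left (Nat.lt_succ_iff.1 m.2)
    rw [hm, Matrix.mul_smul, smul_smul]
    congr 1
    ring
  have hR := reflection_unitary hJ
  set R : Matrix ((Arc M d × Bool) × Counter K) ((Arc M d × Bool) × Counter K) ℂ :=
    (2 : ℂ) • (J * Jᴴ) - 1 with hRdef
  have hneg : ∀ {A : Matrix ((Arc M d × Bool) × Counter K) ((Arc M d × Bool) × Counter K) ℂ},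
      A ∈ Matrix.unitaryGroup _ ℂ → -A ∈ Matrix.unitaryGroup _ ℂ := fun {A} hA => by
    rw [Matrix.mem_unitaryGroup_iff] at hA ⊢
    rw [star_neg, neg_mul_neg, hA]
  refine ⟨fun f => -(T f * R * (T f)ᴴ * R * T f), ?_, fun f => ⟨?_, ?_⟩⟩
  · have h1 := (((((Implementable.gate hι (hneg (one_mem _))).mul hTi).mul
      (Implementable.gate hι hR)).mul (hTi.conjTranspose hTu)).mul
      (Implementable.gate hι hR)).mul hTi
    convert h1 using 1
    · ring
    · funext f
      simp only [Matrix.neg_mul, Matrix.one_mul]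
  · exact hneg (mul_mem (mul_mem (mul_mem (mul_mem (hTu f) hR) (unitary_conjTranspose (hTu f))) hR)
      (hTu f))
  · refine norm_sq_amplify_sub_le (hTu f) hJ (exp_unitary generator_isHermitian β) (hTblock f)
      (norm_taylor_sub_exp_le ?_ K) (pow_le_one₀ (by norm_num) (by norm_num))
    rw [norm_smul]
    have h1 := norm_generator_le (walk_unitary val Λ f) (start_isometry (M := M) hd)
    have h2 : ‖-(Complex.I * (β : ℂ))‖ = β := by simp [abs_of_nonneg hβ]
    rw [h2]
    exact (mul_le_of_le_one_right hβ h1).trans hβ'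

/-- The system in the state `x` and all other logical registers blank. -/
def blankArc (M d K : ℕ) (i₀ : Fin d) (x : Fin M) : (Arc M d × Bool) × Counter K :=
  zeroCounter M d K (withZero M d (x, i₀, i₀))

/-- `r` segments simulate the evolution for time `t`. -/
lemma exists_simulation (K r : ℕ) (a₀ : Fin M × Fin d) (g₀ : G) (b₀ : Fin M × E)
    (hd : d ≠ 0) (val : E → ℂ) {zero : E} (hzero : val zero = 0) {Λ t δ : ℝ} (hΛ : 0 < Λ)
    (ht : 0 ≤ t) (hδ : 0 ≤ δ) (hδΛ : δ ≤ Λ) (hr : 0 < r) (hr' : 4 * (d ^ 2 * Λ * t) ≤ r) :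
    ∃ T : (Fin M × Fin d → Fin M × E) →
        Matrix ((Arc M d × Bool) × Counter K) ((Arc M d × Bool) × Counter K) ℂ,
      Implementable g₀ b₀ (logical K a₀ g₀ b₀) (r * (72 * K)) T ∧
      ∀ f, T f ∈ Matrix.unitaryGroup _ ℂ ∧
        ∀ H : Matrix (Fin M) (Fin M) ℂ, H.IsHermitian → ‖H‖ ≤ Λ → IsBlackBox val zero δ H f →
          ‖T f * inj (blankArc M d K a₀.2) - inj (blankArc M d K a₀.2) * evolution H t‖
            ≤ r * Real.sqrt (10 * (1 / 2) ^ K) + t * (d ^ 2 * δ) := by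
  have hι := logical_injective K a₀ g₀ b₀
  have hr0 : (0 : ℝ) < r := by exact_mod_cast hr
  set β : ℝ := 2 * (d ^ 2 * Λ * t) / r with hβdef
  have hβ : 0 ≤ β := by positivity
  have hβ' : β ≤ 1 / 2 := by rw [hβdef, div_le_iff₀ hr0]; linarith
  obtain ⟨Q, hQ, hQ'⟩ := exists_segment K a₀ g₀ b₀ hd val Λ hβ hβ'
  have hs : Function.Injective fun x : Fin M => withZero M d (x, a₀.2, a₀.2) := fun x y h => by
    simpa [withZero] using h
  have hs' : Function.Injective (blankArc M d K a₀.2) := (zeroCounter_injective M d K).comp hs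
  have hA : (inj (zeroCounter M d K) * start M d)ᴴ * (inj (zeroCounter M d K) * start M d) = 1 := by
    rw [Matrix.conjTranspose_mul, Matrix.mul_assoc, ← Matrix.mul_assoc _ (inj _),
      inj_isometry (zeroCounter_injective M d K), Matrix.one_mul, start_isometry hd]
  obtain ⟨P, hP, hP'⟩ := exists_unitary_mul_inj hs' hA
  refine ⟨fun f => Pᴴ * Q f ^ r * P, ?_, fun f => ⟨mul_mem (mul_mem (unitary_conjTranspose hP)
    (pow_mem (hQ' f).1 r)) hP, fun H hH hn hf => ?_⟩⟩
  · have h1 := ((Implementable.gate hι (unitary_conjTranspose hP)).mul (hQ.pow hι r)).mul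
      (Implementable.gate hι hP)
    simpa using h1
  set J : Matrix ((Arc M d × Bool) × Counter K) (Arc M d × Bool) ℂ := inj (zeroCounter M d K)
  have hJ : ‖J‖ ≤ 1 := norm_le_one_of_isometry (inj_isometry (zeroCounter_injective M d K))
  set S : Matrix (Arc M d × Bool) (Fin M) ℂ := start M d with hSdef
  have hS : Sᴴ * S = 1 := start_isometry hd
  have hS1 : ‖S‖ ≤ 1 := norm_le_one_of_isometry hS
  set Θ := generator (walk val Λ f) S with hΘ
  set h := Sᴴ * walk val Λ f * S with hh
  set F := NormedSpace.exp ((-(Complex.I * (β : ℂ))) • Θ) with hF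
  have hFu : F ∈ Matrix.unitaryGroup _ ℂ := exp_unitary generator_isHermitian β
  have hherm : (((2 * d ^ 2 * Λ : ℝ) : ℂ) • h).IsHermitian := by
    rw [Matrix.IsHermitian, Matrix.conjTranspose_smul, hh, Matrix.conjTranspose_mul,
      Matrix.conjTranspose_mul, walk_isHermitian, Matrix.conjTranspose_conjTranspose,
      Matrix.mul_assoc, Complex.star_def, Complex.conj_ofReal]
  have h1 : ‖Q f * J - J * F‖ ≤ Real.sqrt (10 * (1 / 2) ^ K) := Real.le_sqrt_of_sq_le (hQ' f).2
  have h2 := norm_pow_mul_sub_mul_pow_le (hQ' f).1 hFu h1 r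
  have h3 : F ^ r * S = S * NormedSpace.exp ((-(Complex.I * (t : ℂ))) •
      (((2 * d ^ 2 * Λ : ℝ) : ℂ) • h)) := by
    rw [hF, ← Matrix.exp_nsmul]
    refine exp_mul_eq_mul_exp ?_
    rw [← Nat.cast_smul_eq_nsmul ℂ, smul_smul, smul_smul, Matrix.smul_mul, Matrix.mul_smul,
      generator_mul (walk_isHermitian val Λ f) hS]
    congr 1
    have hrC : (r : ℂ) ≠ 0 := by exact_mod_cast hr.ne'
    rw [hβdef]
    push_cast
    field_simp
  have h4 := norm_exp_sub_exp_le hherm hH ht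
  have h5 := norm_block_sub_le hd hΛ hδ hδΛ hzero hH hn hf
  have e : Pᴴ * Q f ^ r * P * inj (blankArc M d K a₀.2)
        - inj (blankArc M d K a₀.2) * evolution H t
      = Pᴴ * ((Q f ^ r * J - J * F ^ r) * S + J * S *
        (NormedSpace.exp ((-(Complex.I * (t : ℂ))) • (((2 * d ^ 2 * Λ : ℝ) : ℂ) • h))
          - NormedSpace.exp ((-(Complex.I * (t : ℂ))) • H))) := by
    have hPP : Pᴴ * P = 1 := Matrix.mem_unitaryGroup_iff'.1 hP
    have e1 : inj (blankArc M d K a₀.2) = Pᴴ * (J * S) := by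
      rw [← hP', ← Matrix.mul_assoc, hPP, Matrix.one_mul]
    have e2 : Pᴴ * Q f ^ r * P * inj (blankArc M d K a₀.2) = Pᴴ * (Q f ^ r * J * S) := by
      rw [Matrix.mul_assoc, hP']
      simp only [Matrix.mul_assoc]
    rw [e2, e1, evolution, Matrix.sub_mul, Matrix.mul_sub (J * S), Matrix.mul_assoc J (F ^ r), h3,
      Matrix.mul_assoc Pᴴ (J * S), ← Matrix.mul_sub]
    congr 1
    simp only [Matrix.mul_assoc]
    abel
  have hPn := norm_unitary_le_one (unitary_conjTranspose hP)
  have b1 := norm_mul_le_of_norm_le_one h2 hS1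
  have b2 := norm_mul_le_of_norm_le_one (norm_mul_le_of_norm_le_one hJ hS1) h4
  have b3 := norm_mul_le_of_norm_le_one hPn ((norm_add_le _ _).trans (add_le_add b1 b2))
  rw [e]
  refine b3.trans ?_
  have := mul_le_mul_of_nonneg_left h5 ht
  linarith

end Simulation

/-! ### Counting the calls -/

lemma one_le_logStar {n : ℕ} (hn : 2 ≤ n) : 1 ≤ logStar n := by
  have key : ∀ (N : ℕ) (x : ℝ), x < N → ∃ r : ℕ, (Real.logb 2)^[r] x < 2 := by
    intro N
    induction N with
    | zero => intro x hx; exact ⟨0, by push_cast at hx; simpa using by linarith⟩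
    | succ N ih =>
      intro x hx
      by_cases h2 : x < 2
      · exact ⟨0, h2⟩
      · push Not at h2
        have h1 : Real.logb 2 x ≤ x - 1 := by
          rw [Real.logb_le_iff_le_rpow (by norm_num) (by linarith)]
          have := one_add_mul_self_le_rpow_one_add (s := 1) (by norm_num) (p := x - 1)
            (by linarith)
          norm_num at this
          exact this
        push_cast at hx
        obtain ⟨r, hr⟩ := ih (Real.logb 2 x) (by linarith)
        exact ⟨r + 1, by simpa using hr⟩
  rw [Nat.one_le_iff_ne_zero, logStar, Ne, Nat.sInf_eq_zero, not_or]
  refine ⟨?_, ?_⟩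
  · simp only [Set.mem_ofPred_eq, Function.iterate_zero, id_eq, not_lt]
    exact_mod_cast hn
  · obtain ⟨r, hr⟩ := key (n + 1) n (by push_cast; linarith)
    exact Set.Nonempty.ne_empty ⟨r, hr⟩

/-- The number `r` of segments and the degree `K` can be chosen within the bound on the number of
calls, such that the error of the segments is at most `ε / 2`. Here `X` stands for `d² τ`, and
`y ^ (2 k) = X / ε`. -/
lemma exists_parameters {k : ℕ} (hk : 1 ≤ k) {X ε : ℝ} (hX : 1 ≤ 12 * 5 ^ (k - 1) * X)
    (hε : 0 < ε) (hε2 : ε < 2) :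
    ∃ r K : ℕ, 0 < r ∧ 4 * X ≤ r ∧ (r : ℝ) * Real.sqrt (10 * (1 / 2) ^ K) ≤ ε / 2 ∧
      (r : ℝ) * (72 * K) ≤ 22000 * (5 ^ (2 * k) * X ^ (1 + 1 / (2 * (k : ℝ)))
        / ε ^ (1 / (2 * (k : ℝ)))) := by
  have hk5 : (5 : ℝ) ^ k = 5 * 5 ^ (k - 1) := by
    rw [← pow_succ', Nat.sub_add_cancel hk]
  have h5 : (1 : ℝ) ≤ 5 ^ (k - 1) := one_le_pow₀ (by norm_num)
  have hX0 : 0 < X := by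
    by_contra h
    have : 12 * 5 ^ (k - 1) * X ≤ 0 := mul_nonpos_of_nonneg_of_nonpos (by positivity) (not_lt.1 h)
    linarith
  set y : ℝ := (X / ε) ^ (1 / (2 * (k : ℝ))) with hy
  have hy0 : 0 < y := Real.rpow_pos_of_pos (by positivity) _
  have hypow : y ^ (2 * k) = X / ε := by
    rw [hy, ← Real.rpow_natCast, ← Real.rpow_mul (by positivity)]
    push_cast
    rw [one_div_mul_cancel (by positivity), Real.rpow_one]
  -- the lower bound on `X` keeps `y` away from `0`, so that constants are absorbed in `y`
  have hy5 : 1 / 5 ≤ y := by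
    refine le_of_not_gt fun h => ?_
    have h1 : y ^ (2 * k) < (1 / 5) ^ (2 * k) :=
      pow_lt_pow_left₀ h hy0.le (by omega)
    rw [hypow, pow_mul, div_lt_iff₀ hε] at h1
    have h2 : ((1 / 5 : ℝ) ^ 2) ^ k * (5 ^ k * 5 ^ k) = 1 := by
      rw [← mul_pow, ← mul_pow]; norm_num
    have h3 : X * (5 ^ k * 5 ^ k) < 2 := by
      calc X * (5 ^ k * 5 ^ k) < ((1 / 5 : ℝ) ^ 2) ^ k * ε * (5 ^ k * 5 ^ k) :=
            mul_lt_mul_of_pos_right h1 (by positivity)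
        _ = ((1 / 5 : ℝ) ^ 2) ^ k * (5 ^ k * 5 ^ k) * ε := by ring
        _ < 2 := by rw [h2]; linarith
    rw [hk5] at h3
    nlinarith
  set r : ℕ := ⌈4 * X⌉₊ with hr
  set L : ℕ := ⌈y⌉₊ with hL
  -- `(X / ε) ^ 2 = y ^ (4 k) ≤ 2 ^ (4 k L)`, and `2 ^ (14 k)` covers the factors that are
  -- exponential in `k`
  set K : ℕ := k * (14 + 4 * L) with hK
  have hr1 : (r : ℝ) ≤ 16 / 5 * 5 ^ k * X := by
    have := (Nat.ceil_lt_add_one (show 0 ≤ 4 * X by positivity)).le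
    rw [hk5]
    nlinarith
  refine ⟨r, K, Nat.ceil_pos.2 (by positivity), Nat.le_ceil _, ?_, ?_⟩
  · have h2K : 16384 * 25 ^ (k - 1) * (X / ε) ^ 2 ≤ (2 : ℝ) ^ K := by
      have hyL : y ≤ 2 ^ L := (Nat.le_ceil y).trans (by exact_mod_cast (Nat.lt_two_pow_self).le)
      have h4 : y ^ 4 ≤ (2 ^ L) ^ 4 := pow_le_pow_left₀ hy0.le hyL 4
      have e1 : (2 : ℝ) ^ K = 16384 ^ k * ((2 ^ L) ^ 4) ^ k := by
        rw [hK, mul_comm k, pow_mul, pow_add, mul_pow, mul_comm 4 L, pow_mul]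
        norm_num
      have e2 : (X / ε) ^ 2 = (y ^ 4) ^ k := by
        rw [← hypow, ← pow_mul, ← pow_mul]; congr 1; ring
      rw [e1, e2]
      have e3 : (16384 : ℝ) * 25 ^ (k - 1) ≤ 16384 ^ k := by
        calc (16384 : ℝ) * 25 ^ (k - 1) ≤ 16384 * 16384 ^ (k - 1) := by
              gcongr; norm_num
          _ = 16384 ^ k := by rw [← pow_succ', Nat.sub_add_cancel hk]
      gcongr
    have h2K0 : (0 : ℝ) < 2 ^ K := by positivity
    have h25 : (5 : ℝ) ^ k * 5 ^ k = 25 * 25 ^ (k - 1) := by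
      rw [← mul_pow, ← pow_succ', Nat.sub_add_cancel hk]; norm_num
    have hsq : (r : ℝ) ^ 2 * (10 * (1 / 2) ^ K) ≤ (ε / 2) ^ 2 := by
      rw [one_div, inv_pow, ← mul_assoc, ← div_eq_mul_inv, div_le_iff₀ h2K0]
      have a1 : (r : ℝ) ^ 2 ≤ (16 / 5 * 5 ^ k * X) ^ 2 := pow_le_pow_left₀ (by positivity) hr1 2
      have a2 : (16 / 5 * 5 ^ k * X : ℝ) ^ 2 = 256 * (25 ^ (k - 1) * X ^ 2) := by
        rw [mul_pow, mul_pow, sq ((5 : ℝ) ^ k), h25]; ring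
      have a3 : 16384 * (25 ^ (k - 1) * X ^ 2) ≤ ε ^ 2 * 2 ^ K := by
        have := mul_le_mul_of_nonneg_left h2K (sq_nonneg ε)
        have e : ε ^ 2 * (16384 * 25 ^ (k - 1) * (X / ε) ^ 2) = 16384 * (25 ^ (k - 1) * X ^ 2) := by
          field_simp
        rwa [e] at this
      have a4 : (0 : ℝ) ≤ 25 ^ (k - 1) * X ^ 2 := by positivity
      nlinarith
    refine le_of_sq_le_sq ?_ (by positivity)
    rw [mul_pow, Real.sq_sqrt (by positivity)]
    exact hsq
  · have hL1 : (L : ℝ) ≤ y + 1 := (Nat.ceil_lt_add_one hy0.le).le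
    have hkk : (k : ℝ) ≤ 5 ^ k := by
      exact_mod_cast (Nat.lt_pow_self (by norm_num : 1 < 5)).le
    have hK1 : (K : ℝ) ≤ 5 ^ k * (94 * y) := by
      rw [hK]
      push_cast
      have : (14 + 4 * (L : ℝ)) ≤ 94 * y := by linarith
      exact mul_le_mul hkk this (by positivity) (by positivity)
    have hrhs : (5 : ℝ) ^ (2 * k) * X ^ (1 + 1 / (2 * (k : ℝ))) / ε ^ (1 / (2 * (k : ℝ)))
        = 5 ^ k * 5 ^ k * X * y := by
      rw [hy, Real.div_rpow hX0.le hε.le, Real.rpow_add hX0, Real.rpow_one, two_mul, pow_add]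
      ring
    rw [hrhs]
    calc (r : ℝ) * (72 * K) ≤ (16 / 5 * 5 ^ k * X) * (72 * (5 ^ k * (94 * y))) := by gcongr
      _ = 21657.6 * (5 ^ k * 5 ^ k * X * y) := by ring
      _ ≤ 22000 * (5 ^ k * 5 ^ k * X * y) := by
        have : (0 : ℝ) ≤ 5 ^ k * 5 ^ k * X * y := by positivity
        linarith

/-! ### From circuits to simulations -/

section Transfer

variable {M w : ℕ} {Q : Type} [Fintype Q] [DecidableEq Q]

/-- The basis state of the whole register for the state `x` of the system. -/
def blankRest (M w : ℕ) (q₀ : Q) (x : Fin M) : TotalReg (Fin M) w Q := ((x, 0), q₀)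

lemma blankRest_injective (q₀ : Q) : Function.Injective (blankRest M w q₀) :=
  fun _ _ h => congrArg (fun r => r.1.1) h

lemma embed_eq_mulVec (q₀ : Q) (ψ : Fin M → ℂ) :
    embed w q₀ ψ = inj (blankRest M w q₀) *ᵥ ψ := by
  funext ⟨⟨x, z⟩, q⟩
  simp only [embed, Matrix.mulVec, dotProduct, inj_apply, blankRest, Prod.mk.injEq, and_assoc]
  rw [Finset.sum_eq_single x]
  · simp
  · intro b _ hb; simp [hb.symm]
  · simp

lemma star_mulVec_dotProduct {R : Type} [Fintype R] [DecidableEq R] {A : Matrix R (Fin M) ℂ}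
    (hA : Aᴴ * A = 1) {ψ : Fin M → ℂ} (hψ : ∑ x, ‖ψ x‖ ^ 2 = 1) :
    star (A *ᵥ ψ) ⬝ᵥ (A *ᵥ ψ) = 1 := by
  rw [Matrix.star_mulVec, ← Matrix.dotProduct_mulVec, Matrix.mulVec_mulVec, hA, Matrix.one_mulVec,
    dotProduct]
  simp only [Pi.star_apply, Complex.star_def, Complex.conj_mul']
  exact_mod_cast hψ

lemma isometry_mul_unitary {R : Type} [Fintype R] [DecidableEq R] {A : Matrix R (Fin M) ℂ}
    (hA : Aᴴ * A = 1) {B : Matrix (Fin M) (Fin M) ℂ} (hB : B ∈ Matrix.unitaryGroup (Fin M) ℂ) :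
    (A * B)ᴴ * (A * B) = 1 := by
  rw [Matrix.conjTranspose_mul, Matrix.mul_assoc, ← Matrix.mul_assoc _ A, hA, Matrix.one_mul]
  exact Matrix.mem_unitaryGroup_iff'.1 hB

lemma isometry_unitary_mul {R : Type} [Fintype R] [DecidableEq R] {A : Matrix R (Fin M) ℂ}
    (hA : Aᴴ * A = 1) {B : Matrix R R ℂ} (hB : B ∈ Matrix.unitaryGroup R ℂ) :
    (B * A)ᴴ * (B * A) = 1 := by
  rw [Matrix.conjTranspose_mul, Matrix.mul_assoc, ← Matrix.mul_assoc _ B,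
    ← Matrix.star_eq_conjTranspose B, Matrix.mem_unitaryGroup_iff'.1 hB, Matrix.one_mul, hA]

/-- For two isometries, the trace distance of the images of a pure state is at most the distance in
operator norm. -/
lemma traceDist_le_norm {R : Type} [Fintype R] [DecidableEq R] {A B : Matrix R (Fin M) ℂ}
    (hA : Aᴴ * A = 1) (hB : Bᴴ * B = 1) {ψ : Fin M → ℂ} (hψ : ∑ x, ‖ψ x‖ ^ 2 = 1) :
    traceDist (pureState (A *ᵥ ψ)) (pureState (B *ᵥ ψ)) ≤ ‖A - B‖ := by
  refine (traceDist_pureState_le_norm (star_mulVec_dotProduct hA hψ)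
    (star_mulVec_dotProduct hB hψ)).trans ?_
  have h := Matrix.l2_opNorm_mulVec (A - B) (WithLp.toLp 2 ψ)
  have hn : ‖WithLp.toLp 2 ψ‖ = 1 := by
    rw [EuclideanSpace.norm_eq, Real.sqrt_eq_one]
    exact hψ
  rw [hn, mul_one] at h
  rw [← Matrix.sub_mulVec]
  exact h

lemma simulates_nil {H : Matrix (Fin M) (Fin M) ℂ} (hH : H.IsHermitian) (q₀ : Q)
    (U : Matrix Q Q ℂ) (t : ℝ) {ε : ℝ} (hε : 1 ≤ ε) :
    Simulates (w := w) q₀ [] U H t ε := by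
  intro ψ hψ
  have h1 := inj_isometry (blankRest_injective (M := M) (w := w) q₀)
  have h2 := isometry_mul_unitary h1 (exp_unitary hH t)
  rw [circuitOp, Matrix.one_mulVec, embed_eq_mulVec, embed_eq_mulVec, Matrix.mulVec_mulVec]
  exact (traceDist_pureState_le_one (star_mulVec_dotProduct h1 hψ)
    (star_mulVec_dotProduct h2 hψ)).trans hε

/-- A circuit that implements an approximation of the evolution gives a simulation. -/
lemma Implementable.exists_simulates {d n : ℕ} {E G X Y : Type} [Fintype E] [DecidableEq E]
    [Fintype G] [DecidableEq G] [Fintype X] [DecidableEq X] [Fintype Y] [DecidableEq Y]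
    {g₀ : G} {b₀ : Fin M × E} {ι : Y → X × QueryReg M d E G}
    {T : (Fin M × Fin d → Fin M × E) → Matrix Y Y ℂ}
    (h : Implementable g₀ b₀ ι n T) (hι : Function.Injective ι)
    (hT : ∀ f, T f ∈ Matrix.unitaryGroup Y ℂ) (e : X ≃ Fin M × Fin (w + 1))
    {s : Fin M → Y} (hs : Function.Injective s) {q₀ : QueryReg M d E G}
    (hes : ∀ x, (e (ι (s x)).1, (ι (s x)).2) = blankRest M w q₀ x) :
    ∃ c : List (Step (Fin M) w (QueryReg M d E G)), numCalls c = n ∧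
      ∀ f, ∀ U ∈ Matrix.unitaryGroup (QueryReg M d E G) ℂ, Implements g₀ b₀ f U →
        ∀ (H : Matrix (Fin M) (Fin M) ℂ) (t ε : ℝ), H.IsHermitian →
          ‖T f * inj s - inj s * evolution H t‖ ≤ ε → Simulates q₀ c U H t ε := by
  obtain ⟨D, hD, hDT⟩ := h
  obtain ⟨c, hc, hcD⟩ := hD.exists_list e
  refine ⟨c, hc, fun f U hU hf H t ε hH hε ψ hψ => ?_⟩
  set e' : X × QueryReg M d E G ≃ TotalReg (Fin M) w (QueryReg M d E G) :=
    e.prodCongr (Equiv.refl _) with he'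
  have h2 : blankRest M w q₀ = e' ∘ (ι ∘ s) := funext fun x => (hes x).symm
  clear_value e'
  have h1 : circuitOp U c * inj e' = inj e' * D U := by
    rw [hcD, mul_inj]
    ext a b
    rw [Matrix.mul_apply, Finset.sum_eq_single (e'.symm a)]
    · simp [inj_apply]
    · intro b _ hb
      rw [inj_apply, if_neg (fun h => hb (by rw [h, Equiv.symm_apply_apply])), zero_mul]
    · simp
  have h3 : inj (blankRest M w q₀) = inj e' * inj ι * (inj s : Matrix Y (Fin M) ℂ) := by
    rw [h2, inj_comp, inj_comp, Matrix.mul_assoc]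
  have h4 : circuitOp U c * inj (blankRest M w q₀) = inj e' * inj ι * (T f * inj s) := by
    rw [h3, ← Matrix.mul_assoc, ← Matrix.mul_assoc, h1, Matrix.mul_assoc (inj e'), hDT f U hU hf]
    simp only [Matrix.mul_assoc]
  have hE : (inj e' * inj ι)ᴴ * (inj e' * inj ι) = 1 := by
    rw [← inj_comp]
    exact inj_isometry (e'.injective.comp hι)
  have hiso : (circuitOp U c * inj (blankRest M w q₀))ᴴ * (circuitOp U c * inj (blankRest M w q₀))
      = (1 : Matrix (Fin M) (Fin M) ℂ) := by
    rw [h4, Matrix.conjTranspose_mul, Matrix.mul_assoc, ← Matrix.mul_assoc _ (inj e' * inj ι), hE,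
      Matrix.one_mul, isometry_unitary_mul (inj_isometry hs) (hT f)]
  rw [embed_eq_mulVec, embed_eq_mulVec, Matrix.mulVec_mulVec, Matrix.mulVec_mulVec]
  refine (traceDist_le_norm hiso (isometry_mul_unitary
    (inj_isometry (blankRest_injective q₀)) (exp_unitary hH t)) hψ).trans ?_
  have h5 : circuitOp U c * inj (blankRest M w q₀) - inj (blankRest M w q₀) * evolution H t
      = inj e' * inj ι * (T f * inj s - inj s * evolution H t) := by
    rw [h4, h3, Matrix.mul_sub]
    simp only [Matrix.mul_assoc]
  have h6 := norm_mul_le_of_norm_le_one (norm_le_one_of_isometry hE) hε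
  rw [one_mul, ← h5] at h6
  exact h6

end Transfer

/-- The circuit for `r` segments of degree `K`. -/
lemma exists_circuit {M d : ℕ} {E G : Type} [Fintype E] [DecidableEq E] [Fintype G] [DecidableEq G]
    (K r : ℕ) (a₀ : Fin M × Fin d) (g₀ : G) (b₀ : Fin M × E)
    (hd : d ≠ 0) (val : E → ℂ) {zero : E} (hzero : val zero = 0) {Λ t δ : ℝ} (hΛ : 0 < Λ)
    (ht : 0 ≤ t) (hδ : 0 ≤ δ) (hδΛ : δ ≤ Λ) (hr : 0 < r) (hr' : 4 * (d ^ 2 * Λ * t) ≤ r) :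
    ∃ (w : ℕ) (c : List (Step (Fin M) w (QueryReg M d E G))), numCalls c = r * (72 * K) ∧
      ∀ ε : ℝ, r * Real.sqrt (10 * (1 / 2) ^ K) + t * (d ^ 2 * δ) ≤ ε →
        ∀ H : Matrix (Fin M) (Fin M) ℂ, H.IsHermitian → ‖H‖ ≤ Λ →
          ∀ f : Fin M × Fin d → Fin M × E, IsBlackBox val zero δ H f →
          ∀ U ∈ Matrix.unitaryGroup (QueryReg M d E G) ℂ, Implements g₀ b₀ f U →
            Simulates ((a₀, g₀), b₀) c U H t ε := by
  obtain ⟨T, hT, hT'⟩ := exists_simulation K r a₀ g₀ b₀ hd val hzero hΛ ht hδ hδΛ hr hr'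
  -- the registers other than the system and the black box form one ancilla register
  let A : Type := (((Fin d × Fin d) × (Fin M × E) × (Fin M × E)) × Counter K) × Bool
  let e₁ : (LoadedArc M d E × Counter K) × Bool ≃ Fin M × A :=
    { toFun := fun z => (z.1.1.1.1, ((z.1.1.1.2, z.1.1.2), z.1.2), z.2)
      invFun := fun z => ((((z.1, z.2.1.1.1), z.2.1.1.2), z.2.1.2), z.2.2)
      left_inv := fun _ => rfl
      right_inv := fun _ => rfl }
  let blank : A := ((((a₀.2, a₀.2), b₀, b₀), .inl 0), false)
  have : Nonempty A := ⟨blank⟩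
  obtain ⟨w, hw⟩ : ∃ w, Fintype.card A = w + 1 :=
    Nat.exists_eq_succ_of_ne_zero Fintype.card_ne_zero
  let e₂ : A ≃ Fin (w + 1) :=
    (Fintype.equivFinOfCardEq hw).trans (Equiv.swap (Fintype.equivFinOfCardEq hw blank) 0)
  obtain ⟨c, hc, hc'⟩ := hT.exists_simulates (logical_injective K a₀ g₀ b₀) (fun f => (hT' f).1)
    (e₁.trans ((Equiv.refl _).prodCongr e₂)) (s := blankArc M d K a₀.2)
    (q₀ := ((a₀, g₀), b₀)) (fun x y h => by simpa [blankArc, zeroCounter, withZero] using h)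
    (fun x => by
      have : e₂ blank = 0 := by simp [e₂]
      rw [blankRest, ← this]
      rfl)
  exact ⟨w, c, hc, fun ε hε H hH hn f hf U hU hUf => hc' f U hU hUf H t ε hH
    (((hT' f).2 H hH hn hf).trans hε)⟩

end SparseSim

end

open SparseSim

/-- Here `Λ` is an upper bound of `‖H‖` (for instance `‖H‖` itself) and `τ = Λ t`. The circuit is
chosen before `H`, the black-box function `f` and its unitary `U`. -/
theorem theorem2 :
    ∃ C : ℝ, 0 < C ∧
      ∀ (k n d M n' : ℕ) (Λ t τ ε : ℝ),
        1 ≤ k → 2 ≤ n → M ≤ 2 ^ n → 0 < t → 0 < ε → τ = Λ * t →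
        1 ≤ 12 * (d : ℝ) ^ 2 * 5 ^ (k - 1) * τ →
        5 + Real.logb 2 (τ * (d : ℝ) ^ 2 * 5 ^ k / ε) < (n' : ℝ) →
        ∀ (E G : Type) [Fintype E] [DecidableEq E] [Fintype G] [DecidableEq G]
          (val : E → ℂ) (zero : E) (a₀ : Fin M × Fin d) (g₀ : G) (b₀ : Fin M × E),
          val zero = 0 →
          ∃ (w : ℕ) (c : List (Step (Fin M) w (QueryReg M d E G))),
            (numCalls c : ℝ) ≤
              C * ((logStar n : ℝ) * (d : ℝ) ^ 2 * 5 ^ (2 * k) *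
                ((d : ℝ) ^ 2 * τ) ^ (1 + 1 / (2 * (k : ℝ))) / ε ^ (1 / (2 * (k : ℝ)))) ∧
            ∀ H : Matrix (Fin M) (Fin M) ℂ,
              H.IsHermitian → IsSparse d H → specNorm H ≤ Λ →
              ∀ f : Fin M × Fin d → Fin M × E, IsBlackBox val zero (Λ / 2 ^ n') H f →
              ∀ U ∈ Matrix.unitaryGroup (QueryReg M d E G) ℂ, Implements g₀ b₀ f U →
                Simulates ((a₀, g₀), b₀) c U H t ε := by
  refine ⟨22000, by norm_num, ?_⟩
  intro k n d M n' Λ t τ ε hk hn hM ht hε hτ hX hn' E G _ _ _ _ val zero a₀ g₀ b₀ hzero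
  have hd : d ≠ 0 := by rintro rfl; exact a₀.2.elim0
  have hd1 : (1 : ℝ) ≤ d := by exact_mod_cast Nat.one_le_iff_ne_zero.2 hd
  have hd2 : (1 : ℝ) ≤ (d : ℝ) ^ 2 := one_le_pow₀ hd1
  have hX' : 1 ≤ 12 * 5 ^ (k - 1) * ((d : ℝ) ^ 2 * τ) := by linarith
  have hX0 : 0 < (d : ℝ) ^ 2 * τ := by
    by_contra h
    have : 12 * 5 ^ (k - 1) * ((d : ℝ) ^ 2 * τ) ≤ 0 :=
      mul_nonpos_of_nonneg_of_nonpos (by positivity) (not_lt.1 h)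
    linarith
  have hτ0 : 0 < τ := pos_of_mul_pos_right hX0 (by positivity)
  have hΛ : 0 < Λ := pos_of_mul_pos_left (hτ ▸ hτ0) ht.le
  have hL : (1 : ℝ) ≤ logStar n := by exact_mod_cast one_le_logStar hn
  rcases le_or_gt 2 ε with hε2 | hε2
  · -- a trace distance is at most `1`
    refine ⟨0, [], ?_, fun H hH _ _ f _ U _ _ => simulates_nil hH _ U t (by linarith)⟩
    simp only [numCalls, List.map_nil, List.sum_nil, Nat.cast_zero]
    positivity
  obtain ⟨r, K, hr, hr', herr, hcalls⟩ := exists_parameters hk hX' hε hε2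
  have h2n : (0 : ℝ) < 2 ^ n' := by positivity
  have hδΛ : Λ / 2 ^ n' ≤ Λ := div_le_self hΛ.le (one_le_pow₀ (by norm_num))
  have hδ : t * ((d : ℝ) ^ 2 * (Λ / 2 ^ n')) ≤ ε / 2 := by
    have h1 : τ * (d : ℝ) ^ 2 * 5 ^ k / ε < 2 ^ n' := by
      have h2 : Real.logb 2 (τ * (d : ℝ) ^ 2 * 5 ^ k / ε) < (n' : ℝ) - 5 := by linarith
      rw [Real.logb_lt_iff_lt_rpow (by norm_num) (by positivity)] at h2
      refine h2.trans_le ?_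
      rw [← Real.rpow_natCast]
      exact Real.rpow_le_rpow_of_exponent_le (by norm_num) (by linarith)
    rw [div_lt_iff₀ hε] at h1
    have h3 : (2 : ℝ) ≤ 5 ^ k := by
      calc (2 : ℝ) ≤ 5 ^ 1 := by norm_num
        _ ≤ 5 ^ k := pow_le_pow_right₀ (by norm_num) hk
    have h4 : (d : ℝ) ^ 2 * τ * 2 ≤ (d : ℝ) ^ 2 * τ * 5 ^ k := by gcongr
    have e : t * ((d : ℝ) ^ 2 * (Λ / 2 ^ n')) = (d : ℝ) ^ 2 * τ / 2 ^ n' := by rw [hτ]; ring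
    rw [e, div_le_iff₀ h2n]
    linarith
  obtain ⟨w, c, hc, hc'⟩ := exists_circuit K r a₀ g₀ b₀ hd val hzero hΛ ht.le
    (by positivity) hδΛ hr (by rw [mul_assoc ((d : ℝ) ^ 2), ← hτ]; exact hr')
  refine ⟨w, c, ?_, fun H hH _ hn f hf U hU hUf =>
    hc' ε (by linarith) H hH hn f hf U hU hUf⟩
  rw [hc]
  push_cast
  refine hcalls.trans ?_
  have hb : (0 : ℝ) ≤ 5 ^ (2 * k) * ((d : ℝ) ^ 2 * τ) ^ (1 + 1 / (2 * (k : ℝ)))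
      / ε ^ (1 / (2 * (k : ℝ))) := by positivity
  have hLd : (1 : ℝ) ≤ logStar n * (d : ℝ) ^ 2 := one_le_mul_of_one_le_of_one_le hL hd2
  calc 22000 * (5 ^ (2 * k) * ((d : ℝ) ^ 2 * τ) ^ (1 + 1 / (2 * (k : ℝ)))
        / ε ^ (1 / (2 * (k : ℝ))))
      ≤ 22000 * ((logStar n * (d : ℝ) ^ 2) * (5 ^ (2 * k)
        * ((d : ℝ) ^ 2 * τ) ^ (1 + 1 / (2 * (k : ℝ))) / ε ^ (1 / (2 * (k : ℝ))))) := by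
        gcongr
        exact le_mul_of_one_le_left hb hLd
    _ = _ := by ring
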